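/- For $(\tau,\xi)\in\mathbb R\times\mathbb R^2$ put $\langle x\rangle=(1+|x|^2)^{1/2}$, and for dyadic numbers $N,L\in\{1,2,4,\dots\}$ and $0<c<1$ let $$K^{\pm}_{N,L}=\{N\le\langle\xi\rangle\le 2N,\ L\le\langle\tau\pm|\xi|\rangle\le 2L\},\qquad K^{\pm,c}_{N,L}=\{N\le\langle\xi\rangle\le 2N,\ L\le\langle\tau\pm c|\xi|\rangle\le 2L\},$$ let $P_K=\mathcal F_{t,x}^{-1}\chi_K\mathcal F_{t,x}$, and let $$\|f\|_{X^{s,b}_\pm}=\Big(\sum_{N,L}N^{2s}L^{2b}\|P_{K^\pm_{N,L}}f\|_{L^2}^2\Big)^{1/2},\qquad \|f\|_{X^{s,b}_{\pm,c}}=\Big(\sum_{N,L}N^{2s}L^{2b}\|P_{K^{\pm,c}_{N,L}}f\|_{L^2}^2\Big)^{1/2}.$$ For $f,g_1,g_2\in\mathcal S(\mathbb R\times\mathbb R^2)$ and dyadic $N_0,N_1,N_2$ set $$I_1^+=\sum_{L_0,L_1,L_2}\Big|N_1^{-1}\int (P_{K^{\pm,c}_{N_0,L_0}}f)(P_{K^-_{N_1,L_1}}g_1)(P_{K^+_{N_2,L_2}}g_2)\,dt\,dx\Big|,$$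 $$I_2^+=\sum_{L_0,L_1,L_2}\Big|N_0N_1^{-1}N_2^{-1}\int (P_{K^{\pm,c}_{N_0,L_0}}f)(P_{K^-_{N_1,L_1}}g_1)(P_{K^+_{N_2,L_2}}g_2)\,dt\,dx\Big|.$$ Write $N\ll M$ for $N\le\frac{1-c}{8(1+c)}M$ and, for a given $\kappa\ge1$, $N\sim M$ for $\kappa^{-1}M\le N\le\kappa M$. (1) For every $s\in(-\frac{13}{18},0)$ there is $b\in(\frac12,1)$ such that for all $0<c<1$ and $\kappa\ge1$ there is a constant $C$ (depending on $s,b,c,\kappa$ only) such that, for either choice of the sign $\pm$ and all $f,g_1,g_2\in\mathcal S(\mathbb R\times\mathbb R^2)$, $$\Big(\sum_{N_0}\sum_{1\le N_1\ll N_0\sim N_2}+\sum_{N_0}\sum_{1\le N_2\ll N_0\sim N_1}\Big)I_1^+\le C\,\|f\|_{X^{s,b}_{\pm,c}}\|g_1\|_{X^{s,b}_-}\|g_2\|_{X^{-s,1-b}_+},$$ $$\Big(\sum_{N_0}\sum_{1\le N_1\ll N_0\sim N_2}+\sum_{N_0}\sum_{1\le N_2\ll N_0\sim N_1}\Big)I_2^+\le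 C\,\|f\|_{X^{-s,1-b}_{\pm,c}}\|g_1\|_{X^{s,b}_-}\|g_2\|_{X^{s,b}_+}.$$ (2) Let $0<c<1$, $(\tau,\xi)=(\tau_1,\xi_1)+(\tau_2,\xi_2)$. If $|\xi_2|\le\frac{1-c}{2(1+c)}|\xi_1|$ or $|\xi_1|\le\frac{1-c}{2(1+c)}|\xi_2|$, then for either sign $\pm$ $$\max\big(\langle\tau\pm c|\xi|\rangle,\langle\tau_1-|\xi_1|\rangle,\langle\tau_2+|\xi_2|\rangle\big)\ \ge\ \tfrac{1-c}{6}\max(|\xi_1|,|\xi_2|).$$ The same bound holds whenever $N_0\le\langle\xi\rangle\le2N_0$, $N_1\le\langle\xi_1\rangle\le2N_1$, $N_2\le\langle\xi_2\rangle\le2N_2$ for dyadic $N_0,N_1,N_2$ with $N_1\ll N_0\sim N_2$ or $N_2\ll N_0\sim N_1$. -/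

import Mathlib

open MeasureTheory
open scoped FourierTransform ENNReal NNReal SchwartzMap

noncomputable section

namespace KGZ

/-- Space-time `ℝ × ℝ²`: coordinate `0` is the time (or `τ`) variable, coordinates `1, 2` are the
space (or `ξ`) variables. Lebesgue measure is `volume`. -/
abbrev SpaceTime : Type := EuclideanSpace ℝ (Fin 3)

/-- The spatial part `ξ ∈ ℝ²` of `(τ, ξ) ∈ ℝ × ℝ²`. -/
def spatial (p : SpaceTime) : EuclideanSpace ℝ (Fin 2) := !₂[p 1, p 2]

/-- The Japanese bracket `⟨x⟩ = (1 + |x|²)^(1/2)`. -/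
def bracket {E : Type*} [Norm E] (x : E) : ℝ := Real.sqrt (1 + ‖x‖ ^ 2)

/-- The dyadic number `2 ^ n ≥ 1`. All sums over dyadic numbers are sums over the exponents. -/
def dyadic (n : ℕ) : ℝ := 2 ^ n

/-- The modulation `τ + σ a |ξ|` of `(τ, ξ)`, for a sign `σ = ±1` and a speed `a`. -/
def modulation (σ a : ℝ) (p : SpaceTime) : ℝ := p 0 + σ * a * ‖spatial p‖

/-- The dyadic region `{(τ, ξ) : N ≤ ⟨ξ⟩ ≤ 2N, L ≤ ⟨τ + σ a |ξ|⟩ ≤ 2L}` with `N = 2 ^ n` and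
`L = 2 ^ l`. Speed `a = 1` gives `K^±_{N,L}`; speed `a = c` gives `K^{±,c}_{N,L}`. -/
def region (σ a : ℝ) (n l : ℕ) : Set SpaceTime :=
  {p | (dyadic n ≤ bracket (spatial p) ∧ bracket (spatial p) ≤ 2 * dyadic n) ∧
    (dyadic l ≤ bracket (modulation σ a p) ∧ bracket (modulation σ a p) ≤ 2 * dyadic l)}

/-- The Fourier projection `ℱ⁻¹ χ_K ℱ f`. Here `K` is a set of angular frequencies (dual to `(t, x)`
through `exp (i (t τ + x · ξ))`), whereas the variable `η` of Mathlib's Fourier transform is dual to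
`(t, x)` through `exp (2 π i ⟨z, η⟩)`; hence the factor `2 π`. -/
def freqProj (K : Set SpaceTime) (f : 𝓢(SpaceTime, ℂ)) : SpaceTime → ℂ :=
  𝓕⁻ (Set.indicator {η : SpaceTime | (2 * Real.pi) • η ∈ K} (𝓕 (f : SpaceTime → ℂ)))

/-- The Bourgain norm `(∑_{N,L} N^{2s} L^{2b} ‖P_{N,L} f‖²_{L²})^{1/2}`, where `P_{N,L}` is the
projection to `region σ a`: the norm of `X^{s,b}_±` for `a = 1`, of `X^{s,b}_{±,c}` for `a = c`. -/
def bourgainNorm (s b σ a : ℝ) (f : 𝓢(SpaceTime, ℂ)) : ℝ≥0∞ :=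
  (∑' (n : ℕ) (l : ℕ), ENNReal.ofReal (dyadic n ^ (2 * s) * dyadic l ^ (2 * b)) *
    eLpNorm (freqProj (region σ a n l) f) 2 volume ^ 2) ^ (1 / 2 : ℝ)

/-- `∫ (P_{K^{σ,c}_{N₀,L₀}} f) (P_{K^-_{N₁,L₁}} g₁) (P_{K^+_{N₂,L₂}} g₂) dt dx`, where
`n = (n₀, n₁, n₂)` and `l = (l₀, l₁, l₂)` are the exponents of the `N_j` and the `L_j`. -/
def trilinear (c σ : ℝ) (f g₁ g₂ : 𝓢(SpaceTime, ℂ)) (n l : ℕ × ℕ × ℕ) : ℂ :=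
  ∫ z : SpaceTime, freqProj (region σ c n.1 l.1) f z *
    freqProj (region (-1) 1 n.2.1 l.2.1) g₁ z * freqProj (region 1 1 n.2.2 l.2.2) g₂ z

/-- `I₁⁺ = ∑_{L₀,L₁,L₂} |N₁⁻¹ ∫ …|`. -/
def I₁ (c σ : ℝ) (f g₁ g₂ : 𝓢(SpaceTime, ℂ)) (n : ℕ × ℕ × ℕ) : ℝ≥0∞ :=
  ∑' l : ℕ × ℕ × ℕ,
    ENNReal.ofReal ((dyadic n.2.1)⁻¹ * ‖trilinear c σ f g₁ g₂ n l‖)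

/-- `I₂⁺ = ∑_{L₀,L₁,L₂} |N₀ N₁⁻¹ N₂⁻¹ ∫ …|`. -/
def I₂ (c σ : ℝ) (f g₁ g₂ : 𝓢(SpaceTime, ℂ)) (n : ℕ × ℕ × ℕ) : ℝ≥0∞ :=
  ∑' l : ℕ × ℕ × ℕ,
    ENNReal.ofReal (dyadic n.1 * (dyadic n.2.1)⁻¹ * (dyadic n.2.2)⁻¹ *
      ‖trilinear c σ f g₁ g₂ n l‖)

/-- `N ≪ M`, with a threshold that depends on `c` only: `N ≤ (1 - c) / (8 (1 + c)) · M`. -/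
def MuchLess (c N M : ℝ) : Prop := N ≤ (1 - c) / (8 * (1 + c)) * M

/-- `N ∼ M` with constant `κ`: `κ⁻¹ M ≤ N ≤ κ M`. -/
def Comparable (κ N M : ℝ) : Prop := N ≤ κ * M ∧ M ≤ κ * N

/-- The regime `1 ≤ N₁ ≪ N₀ ∼ N₂`. -/
def regime₁ (c κ : ℝ) : Set (ℕ × ℕ × ℕ) :=
  {n | MuchLess c (dyadic n.2.1) (dyadic n.1) ∧ Comparable κ (dyadic n.1) (dyadic n.2.2)}

/-- The regime `1 ≤ N₂ ≪ N₀ ∼ N₁`. -/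
def regime₂ (c κ : ℝ) : Set (ℕ × ℕ × ℕ) :=
  {n | MuchLess c (dyadic n.2.2) (dyadic n.1) ∧ Comparable κ (dyadic n.1) (dyadic n.2.1)}

/-- `(∑_{N₀} ∑_{1 ≤ N₁ ≪ N₀ ∼ N₂} + ∑_{N₀} ∑_{1 ≤ N₂ ≪ N₀ ∼ N₁}) I`. -/
def regimeSum (c κ : ℝ) (I : ℕ × ℕ × ℕ → ℝ≥0∞) : ℝ≥0∞ :=
  ∑' n : regime₁ c κ, I n + ∑' n : regime₂ c κ, I n

/-- `max (⟨τ + σ c |ξ|⟩, ⟨τ₁ - |ξ₁|⟩, ⟨τ₂ + |ξ₂|⟩)` for `(τ, ξ) = (τ₁, ξ₁) + (τ₂, ξ₂)`. -/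
def maxModulation (c σ : ℝ) (p₁ p₂ : SpaceTime) : ℝ :=
  max (bracket (modulation σ c (p₁ + p₂)))
    (max (bracket (modulation (-1) 1 p₁)) (bracket (modulation 1 1 p₂)))

/-- `(1 - c) / 6 · max (|ξ₁|, |ξ₂|) ≤ max (⟨τ + σ c |ξ|⟩, ⟨τ₁ - |ξ₁|⟩, ⟨τ₂ + |ξ₂|⟩)`. -/
def ModulationBound (c σ : ℝ) (p₁ p₂ : SpaceTime) : Prop :=
  (1 - c) / 6 * max ‖spatial p₁‖ ‖spatial p₂‖ ≤ maxModulation c σ p₁ p₂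

/-- `N ≤ ⟨ξ⟩ ≤ 2N` with `N = 2 ^ n`. -/
def InAnnulus (n : ℕ) (p : SpaceTime) : Prop :=
  dyadic n ≤ bracket (spatial p) ∧ bracket (spatial p) ≤ 2 * dyadic n

end KGZ

end

/-! On the Fourier side each trilinear integral is bounded by `convForm` of the absolute values of
the three cut-off transforms, an integral over triples of frequencies with sum zero
(`enorm_integral_fourierInv_mul_le`). Cauchy–Schwarz bounds `convForm` by the square root of the
volume of an intersection of two thickened cones, times three `L²` norms
(`convForm_le_of_volume_le`).

Integrating out time turns that volume into `min L₁ L₂` times the area of a planar level set with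
tolerance `L₁ + L₂`. In a ball of radius `ρ` this area is `O(ρ √(ρ (L₁ + L₂)))`: along suitable
lines the defining function is monotone enough that every section is short
(`exists_volume_transverse_level_le`, `volume_difference_level_le`). So each pair of functions gives
a bound with constant `ρ^(3/4) (L₁ L₂)^(3/8)`, where `ρ` can be taken comparable to the lowest
frequency. When the low frequency belongs to neither function of the pair,
`convForm_le_of_localized_volume_le` first localises both to balls of that size.

Since `c < 1`, a high-low interaction is never resonant: one of the three modulations is at least a
multiple of `N₀` (`modulationBound_of_separated`). The bilinear bound is applied to the pair not
carrying that modulation, and the large modulation then buys a factor `N₀^(-12/25)`. The result is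
`exists_convForm_le`.

All modulation exponents are at most `12/25`, strictly below `1 - b = 49/100`, so the modulation
sums converge geometrically. With `R` the low frequency, the weights leave a spare `R^(-1/200)`
(`frequency_weight_le`), which sums the low frequency. The two comparable high frequencies are
summed by Cauchy–Schwarz near the diagonal. The exponent count works for every `s ≥ -29/40`,
slightly beyond `-13/18`, so one value of `b` serves all `s`. -/

namespace KGZ

/-! ### Parseval's identity, and products as convolutions -/

section Plancherel

variable {V : Type*} [NormedAddCommGroup V] [InnerProductSpace ℝ V] [FiniteDimensional ℝ V]
  [MeasurableSpace V] [BorelSpace V]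

theorem integral_fourierInv_mul_eq {f g : V → ℂ} (hf : Integrable f) (hg : Integrable g) :
    ∫ x, 𝓕⁻ f x * g x = ∫ x, f x * 𝓕⁻ g x := by
  have hg' : Integrable (fun x => g (-x)) := hg.comp_neg
  have h := VectorFourier.integral_fourierIntegral_smul_eq_flip (L := innerₗ V)
      Real.continuous_fourierChar continuous_inner hf hg'
  have h1 : ∀ x, VectorFourier.fourierIntegral Real.fourierChar volume (innerₗ V) f x = 𝓕 f x :=
    fun x => rfl
  have h2 : ∀ x, VectorFourier.fourierIntegral Real.fourierChar volume (innerₗ V).flip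
      (fun x => g (-x)) x = 𝓕⁻ g x := by
    intro x
    rw [Real.fourierInv_eq_fourier_comp_neg]
    simp only [flip_innerₗ]
    rfl
  simp only [h1, h2, smul_eq_mul] at h
  rw [← h, ← integral_neg_eq_self]
  simp [Real.fourierInv_eq_fourier_neg]

theorem continuous_fourierInv {f : V → ℂ} (hf : Integrable f) : Continuous (𝓕⁻ f) := by
  have : Continuous (𝓕 f) := VectorFourier.fourierIntegral_continuous
    Real.continuous_fourierChar (by exact continuous_inner) hf
  have h2 : 𝓕⁻ f = fun x => 𝓕 f (-x) := by
    ext x; exact Real.fourierInv_eq_fourier_neg f x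
  rw [h2]
  exact this.comp continuous_neg

/-- The inverse transform given by an integral and the one given by extension to `L²` define the
same tempered distribution: both are tested against smooth compactly supported functions, and the
transform is moved onto the test function. -/
theorem fourierInv_ae_eq {u : V → ℂ} (h1 : Integrable u) (h2 : MemLp u 2) :
    𝓕⁻ u =ᵐ[volume] ((𝓕⁻ (h2.toLp u) : Lp ℂ 2 (volume : Measure V)) : V → ℂ) := by
  apply ae_eq_of_integral_contDiff_smul_eq
  · exact (continuous_fourierInv h1).locallyIntegrable
  · exact (Lp.memLp _).locallyIntegrable one_le_two
  · intro g g_smooth g_cpt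
    have hg₁ : HasCompactSupport (Complex.ofRealCLM ∘ g) := g_cpt.comp_left rfl
    have hg₂ : ContDiff ℝ ((⊤ : ℕ∞) : WithTop ℕ∞) (Complex.ofRealCLM ∘ g) := by fun_prop
    set φ : 𝓢(V, ℂ) := hg₁.toSchwartzMap hg₂ with hφ
    have hφg : ∀ x, φ x = (g x : ℂ) := fun x => by simp [hφ]
    have key := congrArg (fun T => T φ) (Lp.fourierInv_toTemperedDistribution_eq (h2.toLp u))
    simp only [TemperedDistribution.fourierInv_apply, Lp.toTemperedDistribution_apply] at key
    calc ∫ x, g x • 𝓕⁻ u x = ∫ x, 𝓕⁻ u x * φ x := by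
          congr 1; ext x; rw [hφg, mul_comm]; simp
      _ = ∫ x, u x * 𝓕⁻ (φ : V → ℂ) x := integral_fourierInv_mul_eq h1 φ.integrable
      _ = ∫ x, (𝓕⁻ φ) x • (h2.toLp u) x := by
          apply integral_congr_ae
          filter_upwards [h2.coeFn_toLp] with x hx
          rw [hx, smul_eq_mul, mul_comm, SchwartzMap.fourierInv_coe]
      _ = _ := by
          rw [key]; congr 1

theorem eLpNorm_fourierInv_eq {u : V → ℂ} (h1 : Integrable u) (h2 : MemLp u 2) :
    eLpNorm (𝓕⁻ u) 2 volume = eLpNorm u 2 volume := by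
  rw [eLpNorm_congr_ae (fourierInv_ae_eq h1 h2), ← Lp.enorm_def,
    ← eLpNorm_congr_ae h2.coeFn_toLp, ← Lp.enorm_def, ← ofReal_norm, ← ofReal_norm]
  congr 1
  have := Lp.norm_fourier_eq (𝓕⁻ (h2.toLp u))
  rw [← this, FourierTransform.fourier_fourierInv_eq]

theorem memLp_fourierInv {u : V → ℂ} (h1 : Integrable u) (h2 : MemLp u 2) :
    MemLp (𝓕⁻ u) 2 volume :=
  (Lp.memLp _).ae_eq (fourierInv_ae_eq h1 h2).symm

open ComplexConjugate in
theorem integral_conj_fourierInv_mul_fourierInv {u v : V → ℂ} (hu1 : Integrable u)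
    (hu2 : MemLp u 2) (hv1 : Integrable v) (hv2 : MemLp v 2) :
    ∫ x, conj (𝓕⁻ u x) * 𝓕⁻ v x = ∫ x, conj (u x) * v x := by
  have h := Lp.inner_fourier_eq (𝓕⁻ (hu2.toLp u)) (𝓕⁻ (hv2.toLp v))
  rw [FourierTransform.fourier_fourierInv_eq, FourierTransform.fourier_fourierInv_eq] at h
  rw [L2.inner_def, L2.inner_def] at h
  calc _ = ∫ a, inner ℂ ((𝓕⁻ (hu2.toLp u) : Lp ℂ 2 (volume : Measure V)) a)
        ((𝓕⁻ (hv2.toLp v) : Lp ℂ 2 (volume : Measure V)) a) := by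
        apply integral_congr_ae
        filter_upwards [fourierInv_ae_eq hu1 hu2, fourierInv_ae_eq hv1 hv2] with x hx hy
        rw [hx, hy, RCLike.inner_apply, mul_comm]
    _ = _ := by
        rw [← h]
        apply integral_congr_ae
        filter_upwards [hu2.coeFn_toLp, hv2.coeFn_toLp] with x hx hy
        rw [hx, hy, RCLike.inner_apply, mul_comm]

open ComplexConjugate in
theorem conj_fourierInv (u : V → ℂ) (x : V) :
    conj (𝓕⁻ u x) = 𝓕⁻ (fun y => conj (u (-y))) x := by
  rw [Real.fourierInv_eq, Real.fourierInv_eq, ← integral_conj, ← integral_neg_eq_self]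
  congr 1; ext y
  simp [Circle.smul_def]

/-- Parseval's identity in bilinear form. -/
theorem integral_fourierInv_mul_fourierInv {u v : V → ℂ} (hu1 : Integrable u)
    (hu2 : MemLp u 2) (hv1 : Integrable v) (hv2 : MemLp v 2) :
    ∫ x, 𝓕⁻ u x * 𝓕⁻ v x = ∫ x, u (-x) * v x := by
  have hm : MemLp (fun y => u (-y)) 2 := hu2.comp_measurePreserving
    (Measure.measurePreserving_neg volume)
  have := integral_conj_fourierInv_mul_fourierInv (u := fun y => starRingEnd ℂ (u (-y)))
    (Complex.conjCLE.integrable_comp_iff.2 hu1.comp_neg) hm.star hv1 hv2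
  simpa only [← conj_fourierInv, Complex.conj_conj] using this

theorem fourierInv_comp_sub (u : V → ℂ) (ξ x : V) :
    𝓕⁻ (fun y => u (y - ξ)) x = Real.fourierChar (inner ℝ ξ x) • 𝓕⁻ u x := by
  rw [Real.fourierInv_eq, Real.fourierInv_eq, Circle.smul_def, ← integral_smul,
    ← integral_add_right_eq_self _ ξ]
  congr 1; ext y
  rw [← Circle.smul_def, smul_smul, ← AddChar.map_add_eq_mul]
  simp [inner_add_left, add_comm]

/-- The trilinear form `∫ w(r) ∫ u(-r-q) v(q) dq dr` of nonnegative functions. -/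
noncomputable def convForm (u v w : V → ℝ≥0∞) : ℝ≥0∞ :=
  ∫⁻ r, w r * ∫⁻ q, u (-r - q) * v q

/-- Moving the inverse transform off `w` leaves the inverse transform of a product, which is the
convolution of `u` and `v` at `-r`; the triangle inequality then discards all phases. -/
theorem enorm_integral_fourierInv_mul_le {u v w : V → ℂ} (hu1 : Integrable u)
    (hu2 : MemLp u 2) (hv1 : Integrable v) (hv2 : MemLp v 2) (hw1 : Integrable w) :
    ‖∫ x, 𝓕⁻ w x * 𝓕⁻ u x * 𝓕⁻ v x‖ₑ ≤
      convForm (fun x => ‖u x‖ₑ) (fun x => ‖v x‖ₑ) (fun x => ‖w x‖ₑ) := by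
  have hG : Integrable (fun x => 𝓕⁻ u x * 𝓕⁻ v x) :=
    (memLp_fourierInv hu1 hu2).integrable_mul (memLp_fourierInv hv1 hv2)
  have h1 : ∫ x, 𝓕⁻ w x * 𝓕⁻ u x * 𝓕⁻ v x = ∫ x, w x * 𝓕⁻ (fun x => 𝓕⁻ u x * 𝓕⁻ v x) x := by
    rw [← integral_fourierInv_mul_eq hw1 hG]; simp only [mul_assoc]
  rw [h1]
  refine (enorm_integral_le_lintegral_enorm _).trans ?_
  refine lintegral_mono fun r => ?_
  rw [enorm_mul]
  gcongr
  have h2 : 𝓕⁻ (fun x => 𝓕⁻ u x * 𝓕⁻ v x) r = ∫ q, u (-r - q) * v q := by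
    have := integral_fourierInv_mul_fourierInv (u := fun y => u (y - r)) (hu1.comp_sub_right r)
      (hu2.comp_measurePreserving (measurePreserving_sub_right volume r)) hv1 hv2
    rw [Real.fourierInv_eq]
    calc _ = ∫ x, 𝓕⁻ (fun y => u (y - r)) x * 𝓕⁻ v x := by
          congr 1; ext x; rw [fourierInv_comp_sub, smul_mul_assoc, real_inner_comm]
      _ = _ := by rw [this]; congr 1; ext x; congr 2; abel
  rw [h2]
  refine (enorm_integral_le_lintegral_enorm _).trans ?_
  simp only [enorm_mul, le_refl]

end Plancherel

/-! ### Cauchy–Schwarz and localisation for the trilinear convolution form -/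

/-- The `L²` norm of a nonnegative function. -/
noncomputable def l2Norm {α : Type*} [MeasurableSpace α] (μ : Measure α) (f : α → ℝ≥0∞) : ℝ≥0∞ :=
  (∫⁻ x, f x ^ 2 ∂μ) ^ (1 / 2 : ℝ)

theorem rpow_half_sq (a : ℝ≥0∞) : (a ^ (1 / 2 : ℝ)) ^ 2 = a := by
  rw [← ENNReal.rpow_natCast, ← ENNReal.rpow_mul]; norm_num

theorem sq_rpow_half (a : ℝ≥0∞) : (a ^ 2) ^ (1 / 2 : ℝ) = a := by
  rw [← ENNReal.rpow_natCast, ← ENNReal.rpow_mul]; norm_num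

theorem l2Norm_sq {α : Type*} [MeasurableSpace α] (μ : Measure α) (f : α → ℝ≥0∞) :
    l2Norm μ f ^ 2 = ∫⁻ x, f x ^ 2 ∂μ := rpow_half_sq _

theorem lintegral_mul_le_l2Norm {α : Type*} [MeasurableSpace α] (μ : Measure α)
    {f g : α → ℝ≥0∞} (hf : AEMeasurable f μ) (hg : AEMeasurable g μ) :
    ∫⁻ x, f x * g x ∂μ ≤ l2Norm μ f * l2Norm μ g := by
  have := ENNReal.lintegral_mul_le_Lp_mul_Lq μ Real.HolderConjugate.two_two hf hg
  simpa only [ENNReal.rpow_two, Pi.mul_apply, l2Norm] using this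

theorem eLpNorm_two_eq_l2Norm {α F : Type*} [MeasurableSpace α] [NormedAddCommGroup F]
    (μ : Measure α) (f : α → F) : eLpNorm f 2 μ = l2Norm μ (fun x => ‖f x‖ₑ) := by
  rw [eLpNorm_eq_lintegral_rpow_enorm_toReal two_ne_zero ENNReal.ofNat_ne_top]
  simp [l2Norm]

section ConvForm

variable {V : Type*} [NormedAddCommGroup V] [InnerProductSpace ℝ V] [FiniteDimensional ℝ V]
  [MeasurableSpace V] [BorelSpace V]

theorem convForm_comm (u v w : V → ℝ≥0∞) : convForm u v w = convForm v u w := by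
  unfold convForm
  congr 1; ext r; congr 1
  rw [← lintegral_sub_left_eq_self _ (-r)]
  simp [mul_comm]

/-- Both sides integrate over triples with sum zero. Together with `convForm_comm` this makes the
form fully symmetric, so the bilinear estimate can be applied to any two of the three functions. -/
theorem convForm_right_comm {u v w : V → ℝ≥0∞} (hu : Measurable u) (hv : Measurable v)
    (hw : Measurable w) : convForm u v w = convForm u w v := by
  unfold convForm
  have h1 : ∀ r, w r * ∫⁻ q, u (-r - q) * v q = ∫⁻ q, w r * (u (-r - q) * v q) := fun r => by
    rw [lintegral_const_mul]; fun_prop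
  have h2 : ∀ r, v r * ∫⁻ q, u (-r - q) * w q = ∫⁻ q, v r * (u (-r - q) * w q) := fun r => by
    rw [lintegral_const_mul]; fun_prop
  simp only [h1, h2]
  rw [lintegral_lintegral_swap (by fun_prop)]
  congr 1; ext q; congr 1; ext r
  rw [show -r - q = -q - r by abel]; ring

/-- The Cauchy–Schwarz bound for the trilinear form. -/
theorem convForm_le_of_volume_le {u v w : V → ℝ≥0∞} (hu : Measurable u) (hv : Measurable v)
    (hw : Measurable w) {M : ℝ≥0∞}
    (hM : ∀ r, w r ≠ 0 → volume {q | u (-r - q) ≠ 0 ∧ v q ≠ 0} ≤ M) :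
    convForm u v w ≤ M ^ (1 / 2 : ℝ) * l2Norm volume u * l2Norm volume v * l2Norm volume w := by
  -- Cauchy–Schwarz on the fibre over `r`, against the indicator of the joint support.
  have hin : ∀ r, w r ≠ 0 →
      (∫⁻ q, u (-r - q) * v q) ^ 2 ≤ M * ∫⁻ q, u (-r - q) ^ 2 * v q ^ 2 := by
    intro r hr
    have hmeas : Measurable (fun q => u (-r - q) * v q) := by fun_prop
    set S := {q | u (-r - q) ≠ 0 ∧ v q ≠ 0}
    have hS : MeasurableSet S := by
      have h1 : MeasurableSet {q | u (-r - q) ≠ 0} :=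
        (hu.comp (measurable_const.sub measurable_id)) (measurableSet_singleton 0).compl
      exact h1.inter (hv (measurableSet_singleton 0).compl)
    have h1 : ∫⁻ q, u (-r - q) * v q = ∫⁻ q, S.indicator 1 q * (u (-r - q) * v q) := by
      congr 1; ext q
      by_cases hq : q ∈ S
      · simp [hq]
      · have : u (-r - q) = 0 ∨ v q = 0 := by
          by_contra h; push Not at h; exact hq h
        rcases this with h | h <;> simp [h]
    have h2 := lintegral_mul_le_l2Norm volume (f := S.indicator 1)
      (measurable_one.indicator hS).aemeasurable hmeas.aemeasurable
    have h3 : ∫⁻ q, (S.indicator (1 : V → ℝ≥0∞) q) ^ 2 = volume S := by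
      rw [← lintegral_indicator_one hS]
      congr 1; ext q; by_cases hq : q ∈ S <;> simp [hq]
    calc _ ≤ (l2Norm volume (S.indicator 1) * l2Norm volume fun q => u (-r - q) * v q) ^ 2 := by
          rw [h1]; gcongr
      _ = volume S * ∫⁻ q, (u (-r - q) * v q) ^ 2 := by rw [mul_pow, l2Norm_sq, l2Norm_sq, h3]
      _ ≤ _ := by
          simp only [mul_pow]
          gcongr
          exact hM r hr
  have hmI : Measurable (fun r => ∫⁻ q, u (-r - q) * v q) :=
    Measurable.lintegral_prod_right' (f := fun x : V × V => u (-x.1 - x.2) * v x.2) (by fun_prop)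
  -- The volume hypothesis only covers the support of `w`, so the inner integral is cut off there
  -- before the second Cauchy–Schwarz.
  set S := {r | w r ≠ 0}
  have hS : MeasurableSet S := hw (measurableSet_singleton 0).compl
  set I := S.indicator (fun r => ∫⁻ q, u (-r - q) * v q)
  have h4 : ∫⁻ r, I r ^ 2 ≤
      M * ((∫⁻ x, u x ^ 2) * ∫⁻ x, v x ^ 2) := by
    calc _ ≤ ∫⁻ r, M * ∫⁻ q, u (-r - q) ^ 2 * v q ^ 2 := by
          refine lintegral_mono fun r => ?_
          by_cases hr : r ∈ S
          · simpa only [I, Set.indicator_of_mem hr] using hin r hr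
          · simp [I, Set.indicator_of_notMem hr]
      _ = M * ∫⁻ r, ∫⁻ q, u (-r - q) ^ 2 * v q ^ 2 := by
          rw [lintegral_const_mul]
          exact Measurable.lintegral_prod_right'
            (f := fun x : V × V => u (-x.1 - x.2) ^ 2 * v x.2 ^ 2) (by fun_prop)
      _ = _ := by
          congr 1
          rw [lintegral_lintegral_swap (by fun_prop), ← lintegral_const_mul _ (by fun_prop)]
          congr 1; ext q
          rw [lintegral_mul_const _ (by fun_prop)]
          congr 1
          rw [← lintegral_neg_eq_self]
          simp only [neg_neg]
          exact lintegral_sub_right_eq_self (fun x => u x ^ 2) q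
  have h5 : convForm u v w = ∫⁻ r, w r * I r := by
    unfold convForm
    congr 1; ext r
    by_cases hr : r ∈ S
    · simp only [I, Set.indicator_of_mem hr]
    · rw [show w r = 0 by simpa [S] using hr, zero_mul, zero_mul]
  calc convForm u v w ≤ l2Norm volume w * l2Norm volume I := by
        rw [h5]
        exact lintegral_mul_le_l2Norm volume hw.aemeasurable (hmI.indicator hS).aemeasurable
    _ ≤ l2Norm volume w * (M * ((∫⁻ x, u x ^ 2) * ∫⁻ x, v x ^ 2)) ^ (1 / 2 : ℝ) := by
        gcongr; exact ENNReal.rpow_le_rpow h4 (by norm_num)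
    _ = _ := by
        rw [ENNReal.mul_rpow_of_nonneg _ _ (by norm_num),
          ENNReal.mul_rpow_of_nonneg _ _ (by norm_num)]
        simp only [l2Norm]; ring

/-- Superposition of trilinear forms. -/
theorem const_mul_convForm_le_lintegral {Z : Type*} [MeasurableSpace Z] {ν : Measure Z}
    [SFinite ν] {u v w : V → ℝ≥0∞} {U W : Z × V → ℝ≥0∞} (hU : Measurable U) (hW : Measurable W)
    (hw : Measurable w) {B : ℝ≥0∞} (hB : B ≠ ∞)
    (h : ∀ r, w r ≠ 0 → ∀ q, B * (u (-r - q) * v q) ≤ ∫⁻ z, U (z, -r - q) * W (z, q) ∂ν) :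
    B * convForm u v w ≤ ∫⁻ z, convForm (fun p => U (z, p)) (fun p => W (z, p)) w ∂ν := by
  have hmI : Measurable (fun x : Z × V => ∫⁻ q, U (x.1, -x.2 - q) * W (x.1, q)) :=
    Measurable.lintegral_prod_right'
      (f := fun y : (Z × V) × V => U (y.1.1, -y.1.2 - y.2) * W (y.1.1, y.2)) (by fun_prop)
  have swap1 : ∫⁻ z, convForm (fun p => U (z, p)) (fun p => W (z, p)) w ∂ν =
      ∫⁻ r : V, ∫⁻ z : Z, w r * (∫⁻ q, U (z, -r - q) * W (z, q)) ∂ν := by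
    refine lintegral_lintegral_swap (μ := ν) (ν := volume)
      (f := fun z r => w r * ∫⁻ q, U (z, -r - q) * W (z, q)) (Measurable.aemeasurable ?_)
    exact (hw.comp measurable_snd).mul hmI
  rw [swap1, convForm, ← lintegral_const_mul' _ _ hB]
  refine lintegral_mono fun r => ?_
  by_cases hr : w r = 0
  · simp [hr]
  have swap2 : ∫⁻ z, (∫⁻ q, U (z, -r - q) * W (z, q)) ∂ν =
      ∫⁻ q : V, ∫⁻ z : Z, U (z, -r - q) * W (z, q) ∂ν :=
    lintegral_lintegral_swap (μ := ν) (ν := volume)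
      (f := fun z q => U (z, -r - q) * W (z, q)) (by fun_prop)
  rw [lintegral_const_mul (w r) (f := fun z => ∫⁻ q, U (z, -r - q) * W (z, q))
    (hmI.comp (measurable_id.prodMk measurable_const)), mul_left_comm, swap2,
    ← lintegral_const_mul' _ _ hB]
  gcongr with q
  exact h r hr q

end ConvForm

theorem spatial_add (p q : SpaceTime) : spatial (p + q) = spatial p + spatial q := by
  ext i; fin_cases i <;> simp [spatial]

theorem spatial_neg (p : SpaceTime) : spatial (-p) = -spatial p := by
  ext i; fin_cases i <;> simp [spatial]

theorem spatial_sub (p q : SpaceTime) : spatial (p - q) = spatial p - spatial q := by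
  rw [sub_eq_add_neg, spatial_add, spatial_neg, sub_eq_add_neg]

theorem spatial_smul (a : ℝ) (p : SpaceTime) : spatial (a • p) = a • spatial p := by
  ext i; fin_cases i <;> simp [spatial]

@[fun_prop]
theorem continuous_spatial : Continuous spatial := by
  unfold spatial
  refine (PiLp.continuous_toLp 2 _).comp ?_
  refine continuous_pi fun i => ?_
  fin_cases i <;> simp <;> fun_prop

/-- If the third function lives on spatial frequencies of size `ρ`, then the other two may be
localised to balls of radius comparable to `ρ`. -/
theorem convForm_le_of_localized_volume_le {u v w : SpaceTime → ℝ≥0∞} (hu : Measurable u)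
    (hv : Measurable v) (hw : Measurable w) {ρ : ℝ} (hρ : 0 < ρ)
    (hwρ : ∀ r, w r ≠ 0 → ‖spatial r‖ ≤ ρ) {M : ℝ≥0∞}
    (hM : ∀ z r, volume {q | ‖spatial q - z‖ ≤ ρ ∧ u (-r - q) ≠ 0 ∧ v q ≠ 0} ≤ M) :
    convForm u v w ≤
      2 * (M ^ (1 / 2 : ℝ) * l2Norm volume u * l2Norm volume v * l2Norm volume w) := by
  set E := EuclideanSpace ℝ (Fin 2)
  set B : ℝ≥0∞ := volume (Metric.closedBall (0 : E) ρ) with hB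
  have hB0 : B ≠ 0 := (Metric.measure_closedBall_pos volume _ hρ).ne'
  have hBtop : B ≠ ∞ := measure_closedBall_lt_top.ne
  have hB2 : volume (Metric.closedBall (0 : E) (2 * ρ)) = 4 * B := by
    rw [Measure.addHaar_closedBall_mul _ _ (by norm_num) hρ.le]
    congr 1
    norm_num [E]
  -- The form is averaged over ball centres `z`. If `q` is within `ρ` of `z` and `r` has size at
  -- most `ρ`, then `-r - q` is within `2ρ` of `-z`, hence the larger radius for `u`; its area `4 *
  -- B` produces the final factor 2.
  set U : E × SpaceTime → ℝ≥0∞ :=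
    {x : E × SpaceTime | ‖spatial x.2 + x.1‖ ≤ 2 * ρ}.indicator (fun x => u x.2) with hU
  set W : E × SpaceTime → ℝ≥0∞ :=
    {x : E × SpaceTime | ‖spatial x.2 - x.1‖ ≤ ρ}.indicator (fun x => v x.2) with hW
  have hUm : Measurable U := by
    refine Measurable.indicator (by fun_prop) (IsClosed.measurableSet ?_)
    exact isClosed_le (by fun_prop) continuous_const
  have hWm : Measurable W := by
    refine Measurable.indicator (by fun_prop) (IsClosed.measurableSet ?_)
    exact isClosed_le (by fun_prop) continuous_const
  have hpt : ∀ r, w r ≠ 0 → ∀ q, B * (u (-r - q) * v q) ≤ ∫⁻ z, U (z, -r - q) * W (z, q) := by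
    intro r hr q
    have h1 : ∀ z, (Metric.closedBall (spatial q) ρ).indicator (fun _ => u (-r - q) * v q) z ≤
        U (z, -r - q) * W (z, q) := by
      intro z
      by_cases hz : z ∈ Metric.closedBall (spatial q) ρ
      swap
      · rw [Set.indicator_of_notMem hz]; exact zero_le
      rw [Set.indicator_of_mem hz]
      have hz' : ‖spatial q - z‖ ≤ ρ := by
        rw [← dist_eq_norm, dist_comm]; exact hz
      have hz2 : ‖spatial (-r - q) + z‖ ≤ 2 * ρ := by
        have : spatial (-r - q) + z = -spatial r - (spatial q - z) := by
          rw [spatial_sub, spatial_neg]; abel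
        rw [this]
        refine (norm_sub_le _ _).trans ?_
        rw [norm_neg]; linarith [hwρ r hr]
      rw [hU, hW, Set.indicator_of_mem (by exact hz2), Set.indicator_of_mem (by exact hz')]
    calc B * (u (-r - q) * v q)
        = ∫⁻ z, (Metric.closedBall (spatial q) ρ).indicator (fun _ => u (-r - q) * v q) z := by
          rw [lintegral_indicator measurableSet_closedBall, setLIntegral_const, mul_comm, hB,
            Measure.addHaar_closedBall_center volume (spatial q)]
      _ ≤ _ := lintegral_mono h1
  have step1 : B * convForm u v w ≤
      ∫⁻ z, convForm (fun p => U (z, p)) (fun p => W (z, p)) w :=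
    const_mul_convForm_le_lintegral hUm hWm hw hBtop hpt
  have hconv : ∀ z, convForm (fun p => U (z, p)) (fun p => W (z, p)) w ≤
      M ^ (1 / 2 : ℝ) * l2Norm volume (fun p => U (z, p)) * l2Norm volume (fun p => W (z, p)) *
        l2Norm volume w := by
    intro z
    refine convForm_le_of_volume_le (by fun_prop) (by fun_prop) hw fun r _ => ?_
    refine (measure_mono fun q hq => ?_).trans (hM z r)
    obtain ⟨h1, h2⟩ := hq
    have h3 : (z, q) ∈ {x : E × SpaceTime | ‖spatial x.2 - x.1‖ ≤ ρ} :=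
      Set.mem_of_indicator_ne_zero h2
    exact ⟨h3, fun h => h1 (by simp [hU, h]),
      fun h => h2 (by simp [hW, h])⟩
  have hUsq : Measurable fun z => ∫⁻ p, U (z, p) ^ 2 :=
    Measurable.lintegral_prod_right' (f := fun x => U x ^ 2) (by fun_prop)
  have hWsq : Measurable fun z => ∫⁻ p, W (z, p) ^ 2 :=
    Measurable.lintegral_prod_right' (f := fun x => W x ^ 2) (by fun_prop)
  have hUI : l2Norm volume (fun z => l2Norm volume (fun p => U (z, p))) =
      2 * B ^ (1 / 2 : ℝ) * l2Norm volume u := by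
    have : ∫⁻ z, l2Norm volume (fun p => U (z, p)) ^ 2 = 2 ^ 2 * (B * ∫⁻ p, u p ^ 2) := by
      simp only [l2Norm_sq]
      rw [lintegral_lintegral_swap (by fun_prop), ← lintegral_const_mul _ (by fun_prop),
        ← lintegral_const_mul _ (by fun_prop)]
      congr 1; ext p
      have : (fun z => U (z, p) ^ 2) =
          (Metric.closedBall (-spatial p) (2 * ρ)).indicator (fun _ => u p ^ 2) := by
        ext z
        by_cases hz : ‖spatial p + z‖ ≤ 2 * ρ
        · rw [Set.indicator_of_mem, hU, Set.indicator_of_mem (by exact hz)]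
          rw [Metric.mem_closedBall, dist_eq_norm, sub_neg_eq_add, add_comm]; exact hz
        · rw [Set.indicator_of_notMem, hU, Set.indicator_of_notMem (by exact hz)]
          · simp
          rw [Metric.mem_closedBall, dist_eq_norm, sub_neg_eq_add, add_comm]; exact hz
      rw [this, lintegral_indicator measurableSet_closedBall, setLIntegral_const,
        Measure.addHaar_closedBall_center, hB2]
      ring
    rw [l2Norm, this, ENNReal.mul_rpow_of_nonneg _ _ (by norm_num),
      ENNReal.mul_rpow_of_nonneg _ _ (by norm_num), sq_rpow_half, l2Norm, mul_assoc]
  have hWI : l2Norm volume (fun z => l2Norm volume (fun p => W (z, p))) =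
      B ^ (1 / 2 : ℝ) * l2Norm volume v := by
    have : ∫⁻ z, l2Norm volume (fun p => W (z, p)) ^ 2 = B * ∫⁻ p, v p ^ 2 := by
      simp only [l2Norm_sq]
      rw [lintegral_lintegral_swap (by fun_prop), ← lintegral_const_mul _ (by fun_prop)]
      congr 1; ext p
      have : (fun z => W (z, p) ^ 2) =
          (Metric.closedBall (spatial p) ρ).indicator (fun _ => v p ^ 2) := by
        ext z
        by_cases hz : ‖spatial p - z‖ ≤ ρ
        · rw [Set.indicator_of_mem, hW, Set.indicator_of_mem (by exact hz)]
          rw [Metric.mem_closedBall, dist_comm, dist_eq_norm]; exact hz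
        · rw [Set.indicator_of_notMem, hW, Set.indicator_of_notMem (by exact hz)]
          · simp
          rw [Metric.mem_closedBall, dist_comm, dist_eq_norm]; exact hz
      rw [this, lintegral_indicator measurableSet_closedBall, setLIntegral_const,
        Measure.addHaar_closedBall_center]
      ring
    rw [l2Norm, this, ENNReal.mul_rpow_of_nonneg _ _ (by norm_num), l2Norm]
  have hUl : Measurable fun z => l2Norm volume (fun p => U (z, p)) := hUsq.pow_const _
  have hWl : Measurable fun z => l2Norm volume (fun p => W (z, p)) := hWsq.pow_const _
  have step2 : B * convForm u v w ≤
      B * (2 * (M ^ (1 / 2 : ℝ) * l2Norm volume u * l2Norm volume v * l2Norm volume w)) := by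
    calc B * convForm u v w
        ≤ ∫⁻ z, M ^ (1 / 2 : ℝ) * l2Norm volume w *
          (l2Norm volume (fun p => U (z, p)) * l2Norm volume (fun p => W (z, p))) := by
          refine step1.trans (lintegral_mono fun z => (hconv z).trans_eq (by ring))
      _ = M ^ (1 / 2 : ℝ) * l2Norm volume w * ∫⁻ z,
          (l2Norm volume (fun p => U (z, p)) * l2Norm volume (fun p => W (z, p))) :=
          lintegral_const_mul _ (hUl.mul hWl)
      _ ≤ M ^ (1 / 2 : ℝ) * l2Norm volume w *
          ((2 * B ^ (1 / 2 : ℝ) * l2Norm volume u) * (B ^ (1 / 2 : ℝ) * l2Norm volume v)) := by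
          rw [← hUI, ← hWI]
          gcongr
          exact lintegral_mul_le_l2Norm volume hUl.aemeasurable hWl.aemeasurable
      _ = (B ^ (1 / 2 : ℝ)) ^ 2 *
          (2 * (M ^ (1 / 2 : ℝ) * l2Norm volume u * l2Norm volume v * l2Norm volume w)) := by ring
      _ = _ := by rw [rpow_half_sq]
  exact (ENNReal.mul_le_mul_iff_right hB0 hBtop).1 step2

-- Areas of planar level sets

local notation "Plane" => EuclideanSpace ℝ (Fin 2)

/-- A planar set in a ball of radius `ρ` that meets every line in direction `e` in a set of
diameter at most `D` has area at most `2 ρ D`. -/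
theorem volume_le_of_line_diam_le {S : Set Plane} (hS : MeasurableSet S) {z : Plane} {ρ D : ℝ}
    (hρ : 0 ≤ ρ) (hSz : ∀ η ∈ S, ‖η - z‖ ≤ ρ) {e : Plane} (he : ‖e‖ = 1)
    (hD : ∀ η ∈ S, ∀ t : ℝ, 0 ≤ t → η + t • e ∈ S → t ≤ D) :
    volume S ≤ ENNReal.ofReal (2 * ρ * D) := by
  obtain ⟨b, hb⟩ := Orthonormal.exists_orthonormalBasis_extension_of_card_eq (𝕜 := ℝ)
    (E := Plane) (ι := Fin 2) (by simp) (v := fun _ => e) (s := {0}) (by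
      rw [orthonormal_iff_ite]
      rintro ⟨i, hi⟩ ⟨j, hj⟩
      obtain rfl : i = 0 := hi
      obtain rfl : j = 0 := hj
      simp [he])
  have hb0 : b 0 = e := hb 0 rfl
  let m : ℝ × ℝ → Plane := fun x => b.repr.symm (WithLp.toLp 2 ![x.1, x.2])
  have hm : MeasurePreserving m := by
    have h1 := (volume_preserving_finTwoArrow ℝ).symm
    exact (b.measurePreserving_repr_symm.comp (PiLp.volume_preserving_toLp (Fin 2))).comp h1
  have hmv : ∀ x : ℝ × ℝ, m x = x.1 • e + x.2 • b 1 := by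
    intro x
    simp only [m, ← b.sum_repr_symm, Fin.sum_univ_two, hb0]
    rfl
  rw [← hm.measure_preimage hS.nullMeasurableSet, Measure.volume_eq_prod,
    Measure.prod_apply_symm (hm.measurable hS)]
  set z1 : ℝ := inner ℝ (b 1) z
  have hsec : ∀ y : ℝ, volume ((fun x => (x, y)) ⁻¹' (m ⁻¹' S)) ≤
      (Set.Icc (z1 - ρ) (z1 + ρ)).indicator (fun _ => ENNReal.ofReal D) y := by
    intro y
    by_cases hne : ((fun x => (x, y)) ⁻¹' (m ⁻¹' S)).Nonempty
    · obtain ⟨x, hx⟩ := hne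
      have hx' : m (x, y) ∈ S := hx
      have hy : y ∈ Set.Icc (z1 - ρ) (z1 + ρ) := by
        have h1 := hSz _ hx'
        have h2 : inner ℝ (b 1) (m (x, y) - z) = y - z1 := by
          rw [inner_sub_right, hmv, inner_add_right, inner_smul_right, inner_smul_right, ← hb0]
          have h3 : inner ℝ (b 1) (b 0) = (0 : ℝ) := b.inner_eq_zero (by decide)
          have h4 : inner ℝ (b 1) (b 1) = (1 : ℝ) := b.inner_eq_one 1
          rw [h3, h4]; ring
        have h5 := abs_real_inner_le_norm (b 1) (m (x, y) - z)
        rw [h2, b.norm_eq_one, one_mul] at h5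
        have := abs_le.1 (h5.trans h1)
        constructor <;> linarith
      rw [Set.indicator_of_mem hy]
      refine (Real.volume_le_diam _).trans (Metric.ediam_le fun x₁ h₁ x₂ h₂ => ?_)
      rw [edist_dist, Real.dist_eq]
      refine ENNReal.ofReal_le_ofReal ?_
      have aux : ∀ x₁ x₂ : ℝ, m (x₁, y) ∈ S → m (x₂, y) ∈ S → x₁ ≤ x₂ → x₂ - x₁ ≤ D := by
        intro x₁ x₂ h₁ h₂ h
        refine hD _ h₁ (x₂ - x₁) (by linarith) ?_
        have : m (x₁, y) + (x₂ - x₁) • e = m (x₂, y) := by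
          rw [hmv, hmv]; simp only [sub_smul]; abel
        rwa [this]
      rcases le_total x₁ x₂ with h | h
      · rw [abs_sub_comm, abs_of_nonneg (by linarith)]; exact aux _ _ h₁ h₂ h
      · rw [abs_of_nonneg (by linarith)]; exact aux _ _ h₂ h₁ h
    · rw [Set.not_nonempty_iff_eq_empty] at hne
      rw [hne]; simp
  refine (lintegral_mono hsec).trans ?_
  rw [lintegral_indicator measurableSet_Icc, setLIntegral_const, Real.volume_Icc, mul_comm,
    ← ENNReal.ofReal_mul (by linarith)]
  exact ENNReal.ofReal_le_ofReal (le_of_eq (by ring))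

theorem measurableSet_level {z ζ : Plane} {ρ a Λ ε v : ℝ} :
    MeasurableSet {η : Plane | ‖η - z‖ ≤ ρ ∧ |ε * ‖η‖ + v * ‖ζ - η‖ - a| ≤ Λ} := by
  have h1 : MeasurableSet {η : Plane | ‖η - z‖ ≤ ρ} := measurableSet_le (by fun_prop) (by fun_prop)
  have h2 : MeasurableSet {η : Plane | |ε * ‖η‖ + v * ‖ζ - η‖ - a| ≤ Λ} :=
    (isClosed_le (by fun_prop) (by fun_prop)).measurableSet
  exact h1.inter h2

/-- Compactness of the unit circle: unit vectors satisfy `‖e - u‖² = 2 - 2⟨e, u⟩`, so closeness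
within `√(2(1 - κ))` is the required angle condition. -/
theorem exists_finset_cone_cover {κ : ℝ} (hκ : κ < 1) :
    ∃ t : Finset Plane, (∀ e ∈ t, ‖e‖ = 1) ∧ ∀ η : Plane, ∃ e ∈ t, κ * ‖η‖ ≤ inner ℝ e η := by
  obtain ⟨t, ht, hfin, hcov⟩ := (isCompact_sphere (0 : Plane) 1).finite_cover_balls
    (e := Real.sqrt (2 * (1 - κ))) (Real.sqrt_pos.2 (by linarith))
  have hunit : ∀ u : Plane, ‖u‖ = 1 → ∃ e ∈ t, κ ≤ inner ℝ e u := by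
    intro u hu
    have := hcov (show u ∈ Metric.sphere (0 : Plane) 1 by simpa using hu)
    obtain ⟨e, he, hue⟩ : ∃ e ∈ t, u ∈ Metric.ball e (Real.sqrt (2 * (1 - κ))) := by
      simpa using this
    refine ⟨e, he, ?_⟩
    have he1 : ‖e‖ = 1 := by simpa using ht he
    rw [Metric.mem_ball, dist_comm, dist_eq_norm] at hue
    have h1 := norm_sub_sq_real e u
    have h2 := (Real.lt_sqrt (norm_nonneg _)).1 hue
    rw [he1, hu] at h1
    linarith
  refine ⟨hfin.toFinset, fun e he => by simpa using ht (hfin.mem_toFinset.1 he), fun η => ?_⟩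
  by_cases hη : η = 0
  · obtain ⟨e, he, -⟩ := hunit (EuclideanSpace.single 0 1) (by simp)
    exact ⟨e, hfin.mem_toFinset.2 he, by simp [hη]⟩
  · have hn : 0 < ‖η‖ := norm_pos_iff.2 hη
    obtain ⟨e, he, h⟩ := hunit (‖η‖⁻¹ • η) (by rw [norm_smul, norm_inv, norm_norm]; field_simp)
    refine ⟨e, hfin.mem_toFinset.2 he, ?_⟩
    rw [inner_smul_right, inv_mul_eq_div, le_div_iff₀ hn] at h
    exact h

/-- The area of the level sets of `η ↦ |η| + v |ζ - η|`, `|v| ≤ c < 1`, in a ball. -/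
theorem exists_volume_transverse_level_le {c : ℝ} (hc : c < 1) :
    ∃ C : ℝ, 0 < C ∧ ∀ (ε v : ℝ), (ε = 1 ∨ ε = -1) → |v| ≤ c → ∀ (z ζ : Plane) (a ρ Λ : ℝ),
      0 ≤ ρ → 0 ≤ Λ →
      volume {η : Plane | ‖η - z‖ ≤ ρ ∧ |ε * ‖η‖ + v * ‖ζ - η‖ - a| ≤ Λ} ≤
        ENNReal.ofReal (C * (ρ * Real.sqrt (ρ * Λ))) := by
  -- The aperture is midway between `c` and `1`: along `e`, inside its cone, `‖η‖` grows at rate at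
  -- least `(1 + c) / 2`, while the other term varies at rate at most `c`. The net slope is at least
  -- `(1 - c) / 2`.
  obtain ⟨t, ht, hcov⟩ := exists_finset_cone_cover (κ := (1 + c) / 2) (by linarith)
  set K := Real.sqrt (8 / (1 - c)) with hK
  refine ⟨(t.card + 1) * (2 * K), by
    have : 0 < K := Real.sqrt_pos.2 (div_pos (by norm_num) (by linarith))
    positivity, ?_⟩
  have main : ∀ (v : ℝ), |v| ≤ c → ∀ (z ζ : Plane) (a ρ Λ : ℝ), 0 ≤ ρ → 0 ≤ Λ →
      volume {η : Plane | ‖η - z‖ ≤ ρ ∧ |1 * ‖η‖ + v * ‖ζ - η‖ - a| ≤ Λ} ≤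
        ENNReal.ofReal ((t.card + 1) * (2 * K) * (ρ * Real.sqrt (ρ * Λ))) := by
    intro v hv z ζ a ρ Λ hρ hΛ
    set S := {η : Plane | ‖η - z‖ ≤ ρ ∧ |1 * ‖η‖ + v * ‖ζ - η‖ - a| ≤ Λ}
    have hpiece : ∀ e ∈ t, volume (S ∩ {η | (1 + c) / 2 * ‖η‖ ≤ inner ℝ e η}) ≤
        ENNReal.ofReal (2 * ρ * (K * Real.sqrt (ρ * Λ))) := by
      intro e he
      refine volume_le_of_line_diam_le (z := z) ?_ hρ (fun η hη => hη.1.1) (ht e he) ?_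
      · exact measurableSet_level.inter (isClosed_le (by fun_prop) (by fun_prop)).measurableSet
      rintro η ⟨⟨h1, h2⟩, h3⟩ s hs ⟨⟨h4, h5⟩, -⟩
      have e1 : s ≤ 2 * ρ := by
        have : ‖s • e‖ ≤ ‖η + s • e - z‖ + ‖η - z‖ := by
          have : s • e = (η + s • e - z) - (η - z) := by abel
          conv_lhs => rw [this]
          exact norm_sub_le _ _
        rw [norm_smul, ht e he, Real.norm_of_nonneg hs] at this
        linarith
      have e2 : ‖η‖ + s * ((1 + c) / 2) ≤ ‖η + s • e‖ := by
        have h3' : (1 + c) / 2 * ‖η‖ ≤ inner ℝ e η := h3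
        by_cases hη : ‖η‖ = 0
        · have : η = 0 := norm_eq_zero.1 hη
          rw [this, zero_add, norm_zero, norm_smul, ht e he, Real.norm_of_nonneg hs]
          nlinarith
        · have hpos : 0 < ‖η‖ := lt_of_le_of_ne (norm_nonneg _) (Ne.symm hη)
          have h6 := real_inner_le_norm (η + s • e) η
          rw [inner_add_left, inner_smul_left, real_inner_self_eq_norm_sq] at h6
          simp only [RCLike.conj_to_real] at h6
          have h7 : s * ((1 + c) / 2 * ‖η‖) ≤ s * inner ℝ e η :=
            mul_le_mul_of_nonneg_left h3' hs
          refine le_of_mul_le_mul_right ?_ hpos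
          nlinarith
      have e3 : |‖ζ - (η + s • e)‖ - ‖ζ - η‖| ≤ s := by
        refine (abs_norm_sub_norm_le _ _).trans ?_
        have : ζ - (η + s • e) - (ζ - η) = -(s • e) := by abel
        rw [this, norm_neg, norm_smul, ht e he, Real.norm_of_nonneg hs, mul_one]
      have e4 : |v * (‖ζ - (η + s • e)‖ - ‖ζ - η‖)| ≤ c * s := by
        rw [abs_mul]
        exact mul_le_mul hv e3 (abs_nonneg _) ((abs_nonneg _).trans hv)
      have e5 : s * ((1 - c) / 2) ≤ 2 * Λ := by
        have := (abs_le.1 h2).1; have := (abs_le.1 h5).2; have := (abs_le.1 e4).1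
        nlinarith
      -- The section length is bounded by `2ρ` (`e1`) and by `4Λ / (1 - c)` (`e5`); their geometric
      -- mean is used. The bound by `Λ` alone would lead to modulation exponents `1/2`, too large
      -- for the weight `1 - b`.
      rw [hK, ← Real.sqrt_mul (div_nonneg (by norm_num) (by linarith))]
      refine Real.le_sqrt_of_sq_le ?_
      have hc' : 0 < 1 - c := by linarith
      rw [div_mul_eq_mul_div, le_div_iff₀ hc']
      have : s * (s * ((1 - c) / 2)) ≤ 2 * ρ * (2 * Λ) :=
        mul_le_mul e1 e5 (by positivity) (by positivity)
      nlinarith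
    have hsub : S ⊆ ⋃ e ∈ t, (S ∩ {η | (1 + c) / 2 * ‖η‖ ≤ inner ℝ e η}) := by
      intro η hη
      obtain ⟨e, he, h⟩ := hcov η
      exact Set.mem_biUnion he ⟨hη, h⟩
    calc volume S ≤ ∑ e ∈ t, volume (S ∩ {η | (1 + c) / 2 * ‖η‖ ≤ inner ℝ e η}) :=
          (measure_mono hsub).trans (measure_biUnion_finset_le t _)
      _ ≤ ∑ _e ∈ t, ENNReal.ofReal (2 * ρ * (K * Real.sqrt (ρ * Λ))) := Finset.sum_le_sum hpiece
      _ = ENNReal.ofReal (t.card * (2 * ρ * (K * Real.sqrt (ρ * Λ)))) := by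
          rw [Finset.sum_const, nsmul_eq_mul, ENNReal.ofReal_mul (p := (t.card : ℝ)) (by positivity),
            ENNReal.ofReal_natCast]
      _ ≤ _ := by
          refine ENNReal.ofReal_le_ofReal ?_
          have : 0 ≤ (2 * K) * (ρ * Real.sqrt (ρ * Λ)) := by positivity
          nlinarith
  rintro ε v (rfl | rfl) hv z ζ a ρ Λ hρ hΛ
  · exact main v hv z ζ a ρ Λ hρ hΛ
  · refine le_trans (measure_mono ?_) (main (-v) (by rwa [abs_neg]) z ζ (-a) ρ Λ hρ hΛ)
    intro η hη
    refine ⟨hη.1, ?_⟩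
    have h2 := hη.2
    rw [← abs_neg] at h2
    convert h2 using 2
    ring

theorem exists_unit_orthogonal (ζ : Plane) : ∃ e : Plane, ‖e‖ = 1 ∧ inner ℝ e ζ = (0 : ℝ) := by
  obtain ⟨x, hx, hxζ⟩ : ∃ x : Plane, x ≠ 0 ∧ inner ℝ x ζ = (0 : ℝ) := by
    by_cases h : ζ = 0
    · refine ⟨EuclideanSpace.single 0 1, ?_, by simp [h]⟩
      intro h0
      simpa using congrArg (fun x : Plane => x 0) h0
    · refine ⟨!₂[-ζ 1, ζ 0], fun h0 => h ?_, ?_⟩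
      · ext i
        fin_cases i
        · simpa using congrArg (fun x : Plane => x 1) h0
        · simpa using congrArg (fun x : Plane => x 0) h0
      · simp [PiLp.inner_apply, Fin.sum_univ_two]; ring
  have hn : ‖x‖ ≠ 0 := norm_ne_zero_iff.2 hx
  refine ⟨‖x‖⁻¹ • x, by rw [norm_smul, norm_inv, norm_norm]; field_simp, ?_⟩
  rw [inner_smul_left, hxζ, mul_zero]

/-- The area of the level sets of `η ↦ |η| - |ζ - η|` near the origin. -/
theorem volume_difference_level_le {ε : ℝ} (hε : ε = 1 ∨ ε = -1) (ζ : Plane) (a : ℝ) {ρ Λ : ℝ}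
    (hρ : 0 ≤ ρ) (hΛ : 0 ≤ Λ) :
    volume {η : Plane | (‖η‖ ≤ ρ ∧ 2 * ‖η‖ ≤ ‖ζ - η‖) ∧ |ε * ‖η‖ + -ε * ‖ζ - η‖ - a| ≤ Λ} ≤
      ENNReal.ofReal (16 * (ρ * Real.sqrt (ρ * Λ))) := by
  set S := {η : Plane | (‖η‖ ≤ ρ ∧ 2 * ‖η‖ ≤ ‖ζ - η‖) ∧ |ε * ‖η‖ + -ε * ‖ζ - η‖ - a| ≤ Λ}
  have hS : MeasurableSet S := by
    have h1 : MeasurableSet {η : Plane | ‖η‖ ≤ ρ} := measurableSet_le (by fun_prop) (by fun_prop)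
    have h2 : MeasurableSet {η : Plane | 2 * ‖η‖ ≤ ‖ζ - η‖} :=
      measurableSet_le (by fun_prop) (by fun_prop)
    have h3 : MeasurableSet {η : Plane | |ε * ‖η‖ + -ε * ‖ζ - η‖ - a| ≤ Λ} :=
      (isClosed_le (by fun_prop) (by fun_prop)).measurableSet
    exact (h1.inter h2).inter h3
  -- Moving orthogonally to `ζ` changes `‖η‖²` and `‖ζ - η‖²` by the same amount. On each half-plane
  -- cut out by the sign of `⟨e, η⟩` this amount is at least `s ^ 2`.
  obtain ⟨e₀, he₀, heζ₀⟩ := exists_unit_orthogonal ζ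
  have half : ∀ e : Plane, ‖e‖ = 1 → inner ℝ e ζ = (0 : ℝ) →
      volume (S ∩ {η | 0 ≤ (inner ℝ e η : ℝ)}) ≤
        ENNReal.ofReal (2 * ρ * (3 * Real.sqrt (ρ * Λ))) := by
    intro e he heζ
    refine volume_le_of_line_diam_le (z := 0) ?_ hρ (fun η hη => by simpa using hη.1.1.1) he ?_
    · exact hS.inter (isClosed_le (by fun_prop) (by fun_prop)).measurableSet
    rintro η ⟨⟨⟨h1, h2⟩, h3⟩, h4⟩ s hs ⟨⟨⟨h5, h6⟩, h7⟩, -⟩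
    have h4' : 0 ≤ (inner ℝ e η : ℝ) := h4
    have q1 : ‖η + s • e‖ ^ 2 = ‖η‖ ^ 2 + 2 * s * inner ℝ e η + s ^ 2 := by
      rw [norm_add_sq_real, inner_smul_right, norm_smul, he, Real.norm_of_nonneg hs,
        real_inner_comm]
      ring
    have q2 : ‖ζ - (η + s • e)‖ ^ 2 = ‖ζ - η‖ ^ 2 + 2 * s * inner ℝ e η + s ^ 2 := by
      rw [← sub_sub, norm_sub_sq_real, inner_smul_right, norm_smul, he, Real.norm_of_nonneg hs,
        real_inner_comm, inner_sub_right, heζ]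
      ring
    have hd : |(‖η + s • e‖ - ‖η‖) - (‖ζ - (η + s • e)‖ - ‖ζ - η‖)| ≤ 2 * Λ := by
      have : |(ε * ‖η + s • e‖ + -ε * ‖ζ - (η + s • e)‖ - a) -
          (ε * ‖η‖ + -ε * ‖ζ - η‖ - a)| ≤ 2 * Λ :=
        (abs_sub _ _).trans (by linarith)
      have hε1 : |ε| = 1 := by rcases hε with rfl | rfl <;> simp
      rw [show (ε * ‖η + s • e‖ + -ε * ‖ζ - (η + s • e)‖ - a) -
          (ε * ‖η‖ + -ε * ‖ζ - η‖ - a) = ε * ((‖η + s • e‖ - ‖η‖) -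
          (‖ζ - (η + s • e)‖ - ‖ζ - η‖)) by ring, abs_mul, hε1, one_mul] at this
      exact this
    set X := ‖η‖
    set X' := ‖η + s • e‖
    set Y := ‖ζ - η‖
    set Y' := ‖ζ - (η + s • e)‖
    have hX : 0 ≤ X := norm_nonneg _
    have hX' : 0 ≤ X' := norm_nonneg _
    have hY : 0 ≤ Y := norm_nonneg _
    have hY' : 0 ≤ Y' := norm_nonneg _
    have hsΔ : 0 ≤ 2 * s * (inner ℝ e η : ℝ) := by positivity
    have hYY : Y ≤ Y' := by
      refine le_of_sq_le_sq ?_ hY'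
      nlinarith
    -- Since `Y + Y' ≥ 2 (X + X')` and the squares increase equally, `Y` grows at most half as much
    -- as `X`. Thus `(X' - X) / 2` is controlled by `2Λ`, and `s ^ 2 ≤ (X' - X) (X + X') ≤ 8ρΛ`.
    have r1 : (Y' - Y) * (2 * (X + X')) ≤ (Y' - Y) * (Y + Y') :=
      mul_le_mul_of_nonneg_left (by linarith) (by linarith)
    have r2 : (X' - X) * (X + X') ≤ (2 * Λ + (Y' - Y)) * (X + X') :=
      mul_le_mul_of_nonneg_right (by linarith [(abs_le.1 hd).2]) (by linarith)
    have r3 : Λ * (X + X') ≤ Λ * (2 * ρ) := mul_le_mul_of_nonneg_left (by linarith) hΛ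
    have r4 : s ^ 2 ≤ 9 * (ρ * Λ) := by nlinarith [mul_nonneg hρ hΛ]
    rw [show (3 : ℝ) = Real.sqrt 9 by rw [show (9 : ℝ) = 3 ^ 2 by norm_num]; simp,
      ← Real.sqrt_mul (by norm_num)]
    exact Real.le_sqrt_of_sq_le r4
  have hsub : S ⊆ (S ∩ {η | 0 ≤ (inner ℝ e₀ η : ℝ)}) ∪ (S ∩ {η | 0 ≤ (inner ℝ (-e₀) η : ℝ)}) := by
    intro η hη
    rcases le_total 0 (inner ℝ e₀ η : ℝ) with h | h
    · exact Or.inl ⟨hη, h⟩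
    · exact Or.inr ⟨hη, by simpa using h⟩
  calc volume S ≤ _ := (measure_mono hsub).trans (measure_union_le _ _)
    _ ≤ _ := add_le_add (half e₀ he₀ heζ₀) (half (-e₀) (by simpa using he₀) (by simpa using heζ₀))
    _ = ENNReal.ofReal (2 * ρ * (3 * Real.sqrt (ρ * Λ)) + 2 * ρ * (3 * Real.sqrt (ρ * Λ))) :=
        (ENNReal.ofReal_add (by positivity) (by positivity)).symm
    _ ≤ _ := by
        refine ENNReal.ofReal_le_ofReal ?_
        have : 0 ≤ ρ * Real.sqrt (ρ * Λ) := by positivity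
        nlinarith

/-! ### Integrating out the time frequency -/

theorem measurePreserving_time_spatial :
    MeasurePreserving (fun p : SpaceTime => (p 0, spatial p)) := by
  have h1 := volume_preserving_piFinSuccAbove (fun _ : Fin 3 => ℝ) 0
  have h2 := (PiLp.volume_preserving_ofLp (Fin 3))
  have h3 : MeasurePreserving (Prod.map (id : ℝ → ℝ) (WithLp.toLp 2 : (Fin 2 → ℝ) → Plane)) :=
    (MeasurePreserving.id volume).prod (PiLp.volume_preserving_toLp (Fin 2))
  convert h3.comp (h1.comp h2) using 1
  ext p
  · rfl
  · rename_i i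
    fin_cases i <;> rfl

/-- A space-time set whose time fibres have diameter at most `l`. -/
theorem volume_le_of_time_diam_le {T : Set SpaceTime} {X : Set Plane}
    (hX : MeasurableSet X) {l : ℝ} (hTX : ∀ p ∈ T, spatial p ∈ X)
    (hT : MeasurableSet T)
    (hl : ∀ p ∈ T, ∀ p' ∈ T, spatial p = spatial p' → |p 0 - p' 0| ≤ l) :
    volume T ≤ ENNReal.ofReal l * volume X := by
  let g : ℝ × Plane → SpaceTime := fun x => !₂[x.1, x.2 0, x.2 1]
  have hg : Measurable g := by
    refine Continuous.measurable ((PiLp.continuous_toLp 2 _).comp (continuous_pi fun i => ?_))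
    fin_cases i <;> simp <;> fun_prop
  have hg0 : ∀ x, (g x) 0 = x.1 := fun x => rfl
  have hgs : ∀ x, spatial (g x) = x.2 := fun x => by
    ext i; fin_cases i <;> rfl
  have hgl : ∀ p : SpaceTime, g (p 0, spatial p) = p := fun p => by
    ext i; fin_cases i <;> rfl
  have hTpre : T = (fun p : SpaceTime => (p 0, spatial p)) ⁻¹' (g ⁻¹' T) := by
    ext p; simp [hgl]
  rw [hTpre, measurePreserving_time_spatial.measure_preimage (hg hT).nullMeasurableSet,
    Measure.volume_eq_prod, Measure.prod_apply_symm (hg hT)]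
  have hsec : ∀ y : Plane, volume ((fun x => (x, y)) ⁻¹' (g ⁻¹' T)) ≤
      X.indicator (fun _ => ENNReal.ofReal l) y := by
    intro y
    by_cases hne : ((fun x : ℝ => (x, y)) ⁻¹' (g ⁻¹' T)).Nonempty
    · obtain ⟨x, hx⟩ := hne
      have hy : y ∈ X := by simpa [hgs] using hTX _ (show g (x, y) ∈ T from hx)
      rw [Set.indicator_of_mem hy]
      refine (Real.volume_le_diam _).trans (Metric.ediam_le fun x₁ h₁ x₂ h₂ => ?_)
      rw [edist_dist, Real.dist_eq]
      refine ENNReal.ofReal_le_ofReal ?_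
      simpa [hg0] using hl _ (show g (x₁, y) ∈ T from h₁) _ (show g (x₂, y) ∈ T from h₂)
        (by rw [hgs, hgs])
    · rw [Set.not_nonempty_iff_eq_empty] at hne
      rw [hne]; simp
  refine (lintegral_mono hsec).trans ?_
  rw [lintegral_indicator hX, setLIntegral_const]

/-! ### Non-resonance of high-low interactions -/

theorem continuous_modulation (σ a : ℝ) : Continuous (modulation σ a) := by
  unfold modulation
  fun_prop

theorem abs_le_bracket (x : ℝ) : |x| ≤ bracket x := by
  refine Real.le_sqrt_of_sq_le ?_
  rw [Real.norm_eq_abs]; linarith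

theorem norm_le_bracket {E : Type*} [SeminormedAddGroup E] (x : E) : ‖x‖ ≤ bracket x :=
  Real.le_sqrt_of_sq_le (by linarith)

theorem one_le_dyadic (n : ℕ) : 1 ≤ dyadic n := one_le_pow₀ (by norm_num)

theorem dyadic_pos (n : ℕ) : 0 < dyadic n := by unfold dyadic; positivity

/-- In this combination of modulations the time frequencies cancel; what remains beyond `|ξ₁| -
|ξ₂|` is `σ c |ξ₁ + ξ₂|`. -/
theorem abs_modulation_sub_le {c σ : ℝ} (hc : 0 ≤ c) (hσ : σ = 1 ∨ σ = -1) (p₁ p₂ : SpaceTime) :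
    |(modulation σ c (p₁ + p₂) - modulation (-1) 1 p₁ - modulation 1 1 p₂) -
      (‖spatial p₁‖ - ‖spatial p₂‖)| ≤ c * (‖spatial p₁‖ + ‖spatial p₂‖) := by
  have h1 : (modulation σ c (p₁ + p₂) - modulation (-1) 1 p₁ - modulation 1 1 p₂) -
      (‖spatial p₁‖ - ‖spatial p₂‖) = σ * (c * ‖spatial p₁ + spatial p₂‖) := by
    simp only [modulation, spatial_add, PiLp.add_apply]; ring
  have h2 : |σ| = 1 := by rcases hσ with rfl | rfl <;> simp
  rw [h1, abs_mul, h2, one_mul, abs_of_nonneg (by positivity)]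
  exact mul_le_mul_of_nonneg_left (norm_add_le _ _) hc

/-- The combination of modulations has size at least `(1 - c) max - (1 + c) min`, which separation
makes at least `(1 - c) / 2 · max`. One of three terms carries a third of it. -/
theorem modulationBound_of_separated {c σ : ℝ} (hc0 : 0 < c) (hc1 : c < 1)
    (hσ : σ = 1 ∨ σ = -1) (p₁ p₂ : SpaceTime)
    (h : ‖spatial p₂‖ ≤ (1 - c) / (2 * (1 + c)) * ‖spatial p₁‖ ∨
      ‖spatial p₁‖ ≤ (1 - c) / (2 * (1 + c)) * ‖spatial p₂‖) :
    ModulationBound c σ p₁ p₂ := by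
  have key := abs_le.1 (abs_modulation_sub_le hc0.le hσ p₁ p₂)
  unfold ModulationBound
  have b0 : |modulation σ c (p₁ + p₂)| ≤ maxModulation c σ p₁ p₂ :=
    (abs_le_bracket _).trans (le_max_left _ _)
  have b1 : |modulation (-1) 1 p₁| ≤ maxModulation c σ p₁ p₂ :=
    (abs_le_bracket _).trans ((le_max_left _ _).trans (le_max_right _ _))
  have b2 : |modulation 1 1 p₂| ≤ maxModulation c σ p₁ p₂ :=
    (abs_le_bracket _).trans ((le_max_right _ _).trans (le_max_right _ _))
  have hδ : (1 - c) / (2 * (1 + c)) * (1 + c) = (1 - c) / 2 := by field_simp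
  have hδ1 : (1 - c) / (2 * (1 + c)) ≤ 1 := by rw [div_le_one (by linarith)]; linarith
  set X₁ := ‖spatial p₁‖
  set X₂ := ‖spatial p₂‖
  have hX₁ : 0 ≤ X₁ := norm_nonneg _
  have hX₂ : 0 ≤ X₂ := norm_nonneg _
  rw [abs_le] at b0 b1 b2
  rcases h with h | h
  · have h' : X₂ * (1 + c) ≤ (1 - c) / 2 * X₁ := by
      rw [← hδ]; nlinarith
    rw [max_eq_left (by nlinarith)]
    linarith [key.1, b0.2, b1.1, b2.1]
  · have h' : X₁ * (1 + c) ≤ (1 - c) / 2 * X₂ := by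
      rw [← hδ]; nlinarith
    rw [max_eq_right (by nlinarith)]
    linarith [key.2, b0.1, b1.2, b2.2]

/-- The dyadic threshold `δ` is a quarter of the separation constant. The slack absorbs the factor 2
in the annulus, the 1 in the bracket and the passage from `a + b` to `b`. -/
theorem separated_of_muchLess {c N₀ N₁ : ℝ} (hc0 : 0 < c) (hc1 : c < 1) (hN₁ : 1 ≤ N₁)
    (hN : MuchLess c N₁ N₀) {a b : Plane} (h₀ : N₀ ≤ bracket (a + b)) (h₁ : bracket a ≤ 2 * N₁) :
    ‖a‖ ≤ (1 - c) / (2 * (1 + c)) * ‖b‖ ∧ N₀ / 2 ≤ ‖b‖ := by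
  set δ := (1 - c) / (8 * (1 + c)) with hδ
  have hδ4 : (1 - c) / (2 * (1 + c)) = 4 * δ := by rw [hδ]; field_simp; ring
  have hδ0 : 0 < δ := div_pos (by linarith) (by linarith)
  have hδ8 : δ ≤ 1 / 8 := by
    rw [hδ, div_le_div_iff₀ (by linarith) (by norm_num)]; linarith
  have hN' : N₁ ≤ δ * N₀ := hN
  -- `1 ≤ N₁ ≤ δ N₀` with `δ ≤ 1/8` forces the high frequency away from 1, where bracket and norm
  -- are comparable.
  have hN₀ : 8 ≤ N₀ := by nlinarith
  have s₀ : N₀ ^ 2 ≤ 1 + ‖a + b‖ ^ 2 := by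
    have := (Real.le_sqrt (by linarith) (by positivity)).1 h₀
    exact this
  have s₁ : 1 + ‖a‖ ^ 2 ≤ (2 * N₁) ^ 2 := (Real.sqrt_le_left (by linarith)).1 h₁
  have htri := norm_add_le a b
  have ha := norm_nonneg a
  have hb := norm_nonneg b
  have hab := norm_nonneg (a + b)
  have hδN : N₁ ^ 2 ≤ δ ^ 2 * N₀ ^ 2 := by rw [← mul_pow]; gcongr
  have main : ‖a‖ ≤ 4 * δ * ‖b‖ := by
    by_contra! hcon
    have h1 : 4 * δ * ‖a + b‖ ≤ 3 / 2 * ‖a‖ := by nlinarith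
    have h2 : (4 * δ * ‖a + b‖) ^ 2 ≤ (3 / 2 * ‖a‖) ^ 2 := by gcongr
    have h3 : δ ^ 2 ≤ 1 / 64 := by nlinarith
    have h4 : δ ^ 2 * N₀ ^ 2 ≤ δ ^ 2 * (1 + ‖a + b‖ ^ 2) := by gcongr
    nlinarith
  rw [hδ4]
  refine ⟨main, ?_⟩
  by_contra! hcon
  have h1 : ‖a + b‖ ≤ 3 / 4 * N₀ := by nlinarith
  have h2 : ‖a + b‖ ^ 2 ≤ (3 / 4 * N₀) ^ 2 := by gcongr
  nlinarith

theorem modulationBound_of_mem_regime {c σ κ : ℝ} (hc0 : 0 < c) (hc1 : c < 1)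
    (hσ : σ = 1 ∨ σ = -1) (p₁ p₂ : SpaceTime) {n : ℕ × ℕ × ℕ}
    (hn : n ∈ regime₁ c κ ∪ regime₂ c κ) (h₀ : InAnnulus n.1 (p₁ + p₂))
    (h₁ : InAnnulus n.2.1 p₁) (h₂ : InAnnulus n.2.2 p₂) : ModulationBound c σ p₁ p₂ := by
  have h₀' := h₀.1
  rw [spatial_add] at h₀'
  rcases hn with hn | hn
  · exact modulationBound_of_separated hc0 hc1 hσ p₁ p₂
      (Or.inr (separated_of_muchLess hc0 hc1 (one_le_dyadic _) hn.1 h₀' h₁.2).1)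
  · rw [add_comm] at h₀'
    exact modulationBound_of_separated hc0 hc1 hσ p₁ p₂
      (Or.inl (separated_of_muchLess hc0 hc1 (one_le_dyadic _) hn.1 h₀' h₂.2).1)

/-! ### Bilinear estimates for pairs of cones -/

/-- Reduction of a space-time volume to the area of a planar level set. -/
theorem volume_modulation_pair_le {Y : Set Plane} (hY : MeasurableSet Y) {ε v L₁ L₂ : ℝ}
    (r : SpaceTime) {A : ℝ≥0∞}
    (hA : ∀ a, volume {η : Plane | η ∈ Y ∧ |ε * ‖η‖ + v * ‖-spatial r - η‖ - a| ≤ L₁ + L₂} ≤ A) :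
    volume {q : SpaceTime | spatial q ∈ Y ∧ |modulation ε 1 q| ≤ L₁ ∧
      |modulation 1 v (-r - q)| ≤ L₂} ≤ ENNReal.ofReal (2 * min L₁ L₂) * A := by
  set X : Set Plane := {η | η ∈ Y ∧ |ε * ‖η‖ + v * ‖-spatial r - η‖ - r 0| ≤ L₁ + L₂}
  have hX : MeasurableSet X := by
    have h2 : MeasurableSet {η : Plane | |ε * ‖η‖ + v * ‖-spatial r - η‖ - r 0| ≤ L₁ + L₂} :=
      (isClosed_le (by fun_prop) (by fun_prop)).measurableSet
    exact hY.inter h2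
  have hsp : ∀ q : SpaceTime, spatial (-r - q) = -spatial r - spatial q := fun q => by
    rw [spatial_sub, spatial_neg]
  -- Adding the two modulations eliminates `q 0` and gives the planar condition. For a fixed spatial
  -- part each modulation confines `q 0` to an interval, and the shorter one counts.
  refine (volume_le_of_time_diam_le hX (l := 2 * min L₁ L₂) ?_ ?_ ?_).trans
    (mul_le_mul_right (hA (r 0)) _)
  · rintro q ⟨h1, h2, h3⟩
    refine ⟨h1, ?_⟩
    have h4 := (abs_add_le _ _).trans (add_le_add h2 h3)
    have h5 : ε * ‖spatial q‖ + v * ‖-spatial r - spatial q‖ - r 0 =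
        modulation ε 1 q + modulation 1 v (-r - q) := by
      simp only [modulation, hsp, PiLp.sub_apply, PiLp.neg_apply]
      ring
    rw [← h5] at h4
    exact h4
  · have h2 : MeasurableSet {q : SpaceTime | |modulation ε 1 q| ≤ L₁} :=
      (isClosed_le (continuous_modulation _ _).abs continuous_const).measurableSet
    have h3 : MeasurableSet {q : SpaceTime | |modulation 1 v (-r - q)| ≤ L₂} :=
      (isClosed_le ((continuous_modulation _ _).comp (by fun_prop)).abs
        continuous_const).measurableSet
    exact (continuous_spatial.measurable hY).inter (h2.inter h3)
  · rintro p ⟨-, h2, h3⟩ p' ⟨-, h2', h3'⟩ hpp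
    have e1 : |p 0 - p' 0| ≤ 2 * L₁ := by
      have := (abs_sub _ _).trans (add_le_add h2 h2')
      simp only [modulation, hpp] at this
      rw [add_sub_add_right_eq_sub] at this
      linarith
    have e2 : |p 0 - p' 0| ≤ 2 * L₂ := by
      have := (abs_sub _ _).trans (add_le_add h3 h3')
      simp only [modulation, hsp, hpp, PiLp.sub_apply, PiLp.neg_apply] at this
      rw [add_sub_add_right_eq_sub, sub_sub_sub_cancel_left, abs_sub_comm] at this
      linarith
    rcases min_cases L₁ L₂ with h | h <;> rw [h.1] <;> assumption

/-- For `L₁ ≤ L₂` the left side is about `L₁ L₂^(1/2)`; moving a power `1/4` from `L₁` to `L₂` makes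
it symmetric. -/
theorem min_mul_sqrt_add_le {L₁ L₂ : ℝ} (h₁ : 0 < L₁) (h₂ : 0 < L₂) :
    min L₁ L₂ * Real.sqrt (L₁ + L₂) ≤ 2 * (L₁ * L₂) ^ (3 / 4 : ℝ) := by
  wlog h : L₁ ≤ L₂ generalizing L₁ L₂
  · have := this h₂ h₁ (by linarith)
    rwa [min_comm, add_comm, mul_comm L₂] at this
  rw [min_eq_left h]
  have h1 : Real.sqrt (L₁ + L₂) ≤ 2 * L₂ ^ (1 / 2 : ℝ) := by
    rw [← Real.sqrt_eq_rpow, show (2 : ℝ) = Real.sqrt 4 by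
      rw [show (4 : ℝ) = 2 ^ 2 by norm_num]; simp, ← Real.sqrt_mul (by norm_num)]
    exact Real.sqrt_le_sqrt (by linarith)
  calc L₁ * Real.sqrt (L₁ + L₂) ≤ L₁ * (2 * L₂ ^ (1 / 2 : ℝ)) := by gcongr
    _ = 2 * (L₁ ^ (3 / 4 : ℝ) * L₂ ^ (1 / 2 : ℝ) * L₁ ^ (1 / 4 : ℝ)) := by
        have : L₁ = L₁ ^ (3 / 4 : ℝ) * L₁ ^ (1 / 4 : ℝ) := by
          rw [← Real.rpow_add h₁]; norm_num
        nth_rw 1 [this]; ring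
    _ ≤ 2 * (L₁ ^ (3 / 4 : ℝ) * L₂ ^ (1 / 2 : ℝ) * L₂ ^ (1 / 4 : ℝ)) := by gcongr
    _ = _ := by
        rw [Real.mul_rpow h₁.le h₂.le, mul_assoc, ← Real.rpow_add h₂]; norm_num

/-- The constant in the bilinear estimates. -/
noncomputable def bilinearBound (C ρ L₁ L₂ : ℝ) : ℝ≥0∞ :=
  ENNReal.ofReal (C * (ρ ^ (3 / 4 : ℝ) * (L₁ * L₂) ^ (3 / 8 : ℝ)))

theorem rpow_half_volume_bound_le {C ρ L₁ L₂ : ℝ} (hC : 0 < C) (hρ : 0 < ρ) (h₁ : 0 < L₁)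
    (h₂ : 0 < L₂) {M : ℝ≥0∞}
    (hM : M ≤ ENNReal.ofReal (2 * min L₁ L₂) *
      ENNReal.ofReal (C * (ρ * Real.sqrt (ρ * (L₁ + L₂))))) :
    M ^ (1 / 2 : ℝ) ≤ bilinearBound (2 * Real.sqrt C) ρ L₁ L₂ := by
  have hmin : 0 < min L₁ L₂ := lt_min h₁ h₂
  have hL : 0 < L₁ * L₂ := mul_pos h₁ h₂
  rw [← ENNReal.ofReal_mul (by positivity)] at hM
  have h1 : 2 * min L₁ L₂ * (C * (ρ * Real.sqrt (ρ * (L₁ + L₂)))) ≤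
      (2 * Real.sqrt C * (ρ ^ (3 / 4 : ℝ) * (L₁ * L₂) ^ (3 / 8 : ℝ))) ^ 2 := by
    have e1 : (ρ ^ (3 / 4 : ℝ)) ^ 2 = ρ * Real.sqrt ρ := by
      rw [← Real.rpow_natCast, ← Real.rpow_mul hρ.le, Real.sqrt_eq_rpow]
      nth_rw 2 [← Real.rpow_one ρ]
      rw [← Real.rpow_add hρ]; norm_num
    have e2 : ((L₁ * L₂) ^ (3 / 8 : ℝ)) ^ 2 = (L₁ * L₂) ^ (3 / 4 : ℝ) := by
      rw [← Real.rpow_natCast, ← Real.rpow_mul hL.le]; norm_num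
    rw [mul_pow, mul_pow, mul_pow, Real.sq_sqrt hC.le, e1, e2, Real.sqrt_mul hρ.le]
    have := mul_le_mul_of_nonneg_left (min_mul_sqrt_add_le h₁ h₂)
      (show 0 ≤ 2 * C * ρ * Real.sqrt ρ by positivity)
    nlinarith
  calc M ^ (1 / 2 : ℝ) ≤ (ENNReal.ofReal
        ((2 * Real.sqrt C * (ρ ^ (3 / 4 : ℝ) * (L₁ * L₂) ^ (3 / 8 : ℝ))) ^ 2)) ^ (1 / 2 : ℝ) :=
        ENNReal.rpow_le_rpow (hM.trans (ENNReal.ofReal_le_ofReal h1)) (by norm_num)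
    _ = _ := by
        rw [ENNReal.ofReal_pow (by positivity), sq_rpow_half, bilinearBound]

/-- The Jacobian `(2π)^(-3)` between ordinary and angular frequencies is at most 1 and is dropped.
-/
theorem volume_preimage_two_pi_smul_le (T : Set SpaceTime) :
    volume {q : SpaceTime | (2 * Real.pi) • q ∈ T} ≤ volume T := by
  have h := Measure.addHaar_preimage_smul (volume : Measure SpaceTime)
    (show (2 * Real.pi) ≠ 0 by positivity) T
  have h2 : {q : SpaceTime | (2 * Real.pi) • q ∈ T} = (fun q => (2 * Real.pi) • q) ⁻¹' T := rfl
  rw [h2, h]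
  refine mul_le_of_le_one_left zero_le ?_
  rw [ENNReal.ofReal_le_one, abs_of_nonneg (by positivity)]
  refine inv_le_one_of_one_le₀ (one_le_pow₀ ?_)
  linarith [Real.pi_gt_three]

/-- The bilinear estimate for transverse cones, when one of them or the output is at low frequency. -/
theorem exists_convForm_transverse_le {c : ℝ} (hc0 : 0 ≤ c) (hc : c < 1) :
    ∃ C : ℝ, 0 < C ∧ ∀ (ε σ : ℝ), (ε = 1 ∨ ε = -1) → (σ = 1 ∨ σ = -1) →
      ∀ u v w : SpaceTime → ℝ≥0∞, Measurable u → Measurable v → Measurable w →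
      ∀ ρ L₁ L₂ : ℝ, 0 < ρ → 0 < L₁ → 0 < L₂ →
      (∀ p, u p ≠ 0 → |modulation σ c ((2 * Real.pi) • p)| ≤ L₂) →
      (∀ p, v p ≠ 0 → |modulation ε 1 ((2 * Real.pi) • p)| ≤ L₁) →
      ((∀ p, v p ≠ 0 → ‖spatial ((2 * Real.pi) • p)‖ ≤ ρ) ∨
        (∀ p, w p ≠ 0 → ‖spatial ((2 * Real.pi) • p)‖ ≤ ρ)) →
      convForm u v w ≤ bilinearBound C ρ L₁ L₂ *
        (l2Norm volume u * l2Norm volume v * l2Norm volume w) := by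
  obtain ⟨C, hC, harea⟩ := exists_volume_transverse_level_le hc
  refine ⟨2 * (2 * Real.sqrt C), by positivity, ?_⟩
  intro ε σ hε hσ u v w hu hv hw ρ L₁ L₂ hρ h₁ h₂ hus hvs hlow
  have hσc : |σ * c| ≤ c := by rcases hσ with rfl | rfl <;> simp [abs_of_nonneg hc0]
  have h2π : 0 < 2 * Real.pi := by positivity
  set M := ENNReal.ofReal (2 * min L₁ L₂) *
    ENNReal.ofReal (C * (ρ * Real.sqrt (ρ * (L₁ + L₂)))) with hMdef
  have hvol : ∀ (z : Plane) (r : SpaceTime), volume {q : SpaceTime |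
      ‖spatial ((2 * Real.pi) • q) - z‖ ≤ ρ ∧ u (-r - q) ≠ 0 ∧ v q ≠ 0} ≤ M := by
    intro z r
    have h := volume_modulation_pair_le (Y := {η : Plane | ‖η - z‖ ≤ ρ})
      (measurableSet_le (by fun_prop) (by fun_prop)) (ε := ε) (v := σ * c) (L₁ := L₁) (L₂ := L₂)
      ((2 * Real.pi) • r) (fun a => harea ε (σ * c) hε hσc z _ a ρ (L₁ + L₂) hρ.le (by linarith))
    refine le_trans (measure_mono ?_) ((volume_preimage_two_pi_smul_le _).trans h)
    rintro q ⟨e1, e2, e3⟩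
    refine ⟨e1, hvs q e3, ?_⟩
    have := hus _ e2
    rw [smul_sub, smul_neg] at this
    simpa only [modulation, one_mul] using this
  have hMb := rpow_half_volume_bound_le hC hρ h₁ h₂ (M := M) le_rfl
  have hdouble : bilinearBound (2 * (2 * Real.sqrt C)) ρ L₁ L₂ =
      2 * bilinearBound (2 * Real.sqrt C) ρ L₁ L₂ := by
    rw [bilinearBound, mul_assoc 2 (2 * Real.sqrt C), ENNReal.ofReal_mul (by norm_num)]
    simp [bilinearBound]
  have hfin : 2 * (M ^ (1 / 2 : ℝ) * l2Norm volume u * l2Norm volume v * l2Norm volume w) ≤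
      bilinearBound (2 * (2 * Real.sqrt C)) ρ L₁ L₂ *
        (l2Norm volume u * l2Norm volume v * l2Norm volume w) := by
    rw [hdouble]
    calc _ = 2 * M ^ (1 / 2 : ℝ) * (l2Norm volume u * l2Norm volume v * l2Norm volume w) := by
          ring
      _ ≤ _ := by gcongr
  -- If `v` is at low frequency, its support already lies in a ball of radius `ρ`. If only `w` is,
  -- both other functions must first be localised.
  rcases hlow with hlow | hlow
  · refine le_trans ?_ hfin
    refine (convForm_le_of_volume_le hu hv hw (M := M) fun r _ => ?_).trans
      (le_mul_of_one_le_left zero_le one_le_two)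
    refine (measure_mono ?_).trans (hvol 0 r)
    rintro q ⟨e1, e2⟩
    exact ⟨by simpa using hlow q e2, e1, e2⟩
  · refine le_trans ?_ hfin
    refine convForm_le_of_localized_volume_le hu hv hw (ρ := ρ / (2 * Real.pi))
      (by positivity) ?_ ?_
    · intro r hr
      have := hlow r hr
      rw [spatial_smul, norm_smul, Real.norm_of_nonneg h2π.le] at this
      rw [le_div_iff₀ h2π]; linarith
    · intro z r
      refine (measure_mono ?_).trans (hvol ((2 * Real.pi) • z) r)
      rintro q ⟨e1, e2, e3⟩
      refine ⟨?_, e2, e3⟩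
      rw [spatial_smul, ← smul_sub, norm_smul, Real.norm_of_nonneg h2π.le]
      rw [le_div_iff₀ h2π] at e1; linarith

/-- The bilinear estimate for the forward and the backward cone, at separated frequencies. -/
theorem convForm_opposite_le {ε : ℝ} (hε : ε = 1 ∨ ε = -1) {u v w : SpaceTime → ℝ≥0∞}
    (hu : Measurable u) (hv : Measurable v) (hw : Measurable w) {ρ L₁ L₂ : ℝ} (hρ : 0 < ρ)
    (h₁ : 0 < L₁) (h₂ : 0 < L₂)
    (hus : ∀ p, u p ≠ 0 → |modulation (-ε) 1 ((2 * Real.pi) • p)| ≤ L₂)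
    (hvs : ∀ p, v p ≠ 0 → |modulation ε 1 ((2 * Real.pi) • p)| ≤ L₁)
    (hvρ : ∀ p, v p ≠ 0 → ‖spatial ((2 * Real.pi) • p)‖ ≤ ρ)
    (hsep : ∀ r q, w r ≠ 0 → u (-r - q) ≠ 0 → v q ≠ 0 →
      2 * ‖spatial ((2 * Real.pi) • q)‖ ≤ ‖spatial ((2 * Real.pi) • (-r - q))‖) :
    convForm u v w ≤ bilinearBound (2 * Real.sqrt 16) ρ L₁ L₂ *
      (l2Norm volume u * l2Norm volume v * l2Norm volume w) := by
  set M := ENNReal.ofReal (2 * min L₁ L₂) *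
    ENNReal.ofReal (16 * (ρ * Real.sqrt (ρ * (L₁ + L₂)))) with hMdef
  have hMb := rpow_half_volume_bound_le (by norm_num) hρ h₁ h₂ (M := M) le_rfl
  have hvol : ∀ r, w r ≠ 0 → volume {q | u (-r - q) ≠ 0 ∧ v q ≠ 0} ≤ M := by
    intro r hr
    have hY : MeasurableSet {η : Plane | ‖η‖ ≤ ρ ∧
        2 * ‖η‖ ≤ ‖-spatial ((2 * Real.pi) • r) - η‖} := by
      have h1 : MeasurableSet {η : Plane | ‖η‖ ≤ ρ} :=
        measurableSet_le (by fun_prop) (by fun_prop)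
      have h2 : MeasurableSet {η : Plane | 2 * ‖η‖ ≤ ‖-spatial ((2 * Real.pi) • r) - η‖} :=
        measurableSet_le (by fun_prop) (by fun_prop)
      exact h1.inter h2
    have h := volume_modulation_pair_le hY (ε := ε) (v := -ε) (L₁ := L₁) (L₂ := L₂)
      ((2 * Real.pi) • r) (fun a => volume_difference_level_le hε _ a hρ.le (by linarith))
    refine le_trans (measure_mono ?_) ((volume_preimage_two_pi_smul_le _).trans h)
    rintro q ⟨e2, e3⟩
    have hsm : (2 * Real.pi) • (-r - q) = -(2 * Real.pi) • r - (2 * Real.pi) • q := by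
      rw [smul_sub, smul_neg, neg_smul]
    refine ⟨⟨hvρ q e3, ?_⟩, hvs q e3, ?_⟩
    · have := hsep r q hr e2 e3
      rwa [hsm, neg_smul, spatial_sub, spatial_neg] at this
    · have := hus _ e2
      rw [hsm, neg_smul] at this
      simpa only [modulation, one_mul, mul_one] using this
  refine (convForm_le_of_volume_le hu hv hw hvol).trans ?_
  rw [mul_assoc, mul_assoc, ← mul_assoc (l2Norm volume u)]
  gcongr

/-! ### The trilinear estimate for dyadic pieces -/

theorem bracket_neg {E : Type*} [SeminormedAddGroup E] (x : E) : bracket (-x) = bracket x := by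
  simp [bracket]

theorem modulation_neg (σ a : ℝ) (p : SpaceTime) :
    modulation (-σ) a (-p) = -modulation σ a p := by
  simp only [modulation, spatial_neg, norm_neg, PiLp.neg_apply]; ring

/-- In a high-low interaction one of the modulations dominates the high frequency. -/
theorem le_modulation_of_mem_region {c : ℝ} (hc0 : 0 < c) (hc1 : c < 1) {ε σ : ℝ}
    (hε : ε = 1 ∨ ε = -1) (hσ : σ = 1 ∨ σ = -1) {n₀ n₁ n₂ l₀ l₁ l₂ : ℕ}
    (hn : MuchLess c (dyadic n₁) (dyadic n₀)) {r p q : SpaceTime} (hsum : r + p + q = 0)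
    (hr : r ∈ region σ c n₀ l₀) (hp : p ∈ region ε 1 n₂ l₂) (hq : q ∈ region (-ε) 1 n₁ l₁) :
    (1 - c) / 24 * dyadic n₀ ≤ dyadic l₀ ∨ (1 - c) / 24 * dyadic n₀ ≤ dyadic l₁ ∨
      (1 - c) / 24 * dyadic n₀ ≤ dyadic l₂ := by
  -- The convolution form has sum zero whereas the modulation bound has `p₁ + p₂` as output;
  -- reflecting `r` flips the sign `σ`.
  have hr' : q + p = -r := by rw [eq_neg_iff_add_eq_zero, ← hsum]; abel
  have h₀ : dyadic n₀ ≤ bracket (spatial q + spatial p) := by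
    rw [← spatial_add, hr', spatial_neg, bracket_neg]; exact hr.1.1
  obtain ⟨hs1, hs2⟩ := separated_of_muchLess hc0 hc1 (one_le_dyadic _) hn h₀ hq.1.2
  have hm₀ : bracket (modulation (-σ) c (q + p)) ≤ 2 * dyadic l₀ := by
    rw [hr', modulation_neg, bracket_neg]; exact hr.2.2
  have hσ' : -σ = 1 ∨ -σ = -1 := by rcases hσ with rfl | rfl <;> simp
  have key : (1 - c) / 6 * ‖spatial p‖ ≤
      max (2 * dyadic l₀) (max (2 * dyadic l₁) (2 * dyadic l₂)) := by
    rcases hε with rfl | rfl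
    · have hb := modulationBound_of_separated hc0 hc1 hσ' q p (Or.inr hs1)
      have h1 : maxModulation c (-σ) q p ≤
          max (2 * dyadic l₀) (max (2 * dyadic l₁) (2 * dyadic l₂)) :=
        max_le_max hm₀ (max_le_max hq.2.2 hp.2.2)
      refine le_trans ?_ (hb.trans h1)
      exact mul_le_mul_of_nonneg_left (le_max_right _ _) (by linarith)
    · rw [add_comm] at hm₀
      have hb := modulationBound_of_separated hc0 hc1 hσ' p q (Or.inl hs1)
      have hq2 := hq.2.2
      rw [neg_neg] at hq2
      have h1 : maxModulation c (-σ) p q ≤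
          max (2 * dyadic l₀) (max (2 * dyadic l₁) (2 * dyadic l₂)) := by
        rw [max_comm (2 * dyadic l₁)]
        exact max_le_max hm₀ (max_le_max hp.2.2 hq2)
      refine le_trans ?_ (hb.trans h1)
      exact mul_le_mul_of_nonneg_left (le_max_left _ _) (by linarith)
  have h2 : (1 - c) / 6 * (dyadic n₀ / 2) ≤ (1 - c) / 6 * ‖spatial p‖ :=
    mul_le_mul_of_nonneg_left hs2 (by linarith)
  rcases le_max_iff.1 (h2.trans key) with h | h
  · exact Or.inl (by linarith)
  · rcases le_max_iff.1 h with h | h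
    · exact Or.inr (Or.inl (by linarith))
    · exact Or.inr (Or.inr (by linarith))

theorem bilinearBound_mono {C C' ρ L₁ L₂ : ℝ} (h : C ≤ C') (hρ : 0 ≤ ρ) (h₁ : 0 ≤ L₁)
    (h₂ : 0 ≤ L₂) : bilinearBound C ρ L₁ L₂ ≤ bilinearBound C' ρ L₁ L₂ := by
  unfold bilinearBound
  gcongr

/-- Here `w` is the dominant modulation, absent from the bilinear bound: `(w / (a N))^(12/25) ≥ 1`
is inserted for free. The exponents `3/8` of `x, y ≥ 1` are raised to `12/25` for symmetry. -/
theorem bilinearBound_le {C a N R x y w : ℝ} (hC : 0 < C) (ha : 0 < a) (hN : 0 < N) (hR : 0 < R)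
    (hx : 1 ≤ x) (hy : 1 ≤ y) (hw : a * N ≤ w) :
    bilinearBound C (2 * R) (2 * x) (2 * y) ≤ ENNReal.ofReal (C * 4 * a ^ (-(12 / 25) : ℝ) *
      (R ^ (3 / 4 : ℝ) * N ^ (-(12 / 25) : ℝ) * (x * y * w) ^ (12 / 25 : ℝ))) := by
  refine ENNReal.ofReal_le_ofReal ?_
  have hxy : 1 ≤ x * y := one_le_mul_of_one_le_of_one_le hx hy
  have hw0 : 0 < w := lt_of_lt_of_le (by positivity) hw
  have e1 : (2 * R) ^ (3 / 4 : ℝ) ≤ 2 * R ^ (3 / 4 : ℝ) := by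
    rw [Real.mul_rpow (by norm_num) hR.le]
    gcongr
    exact (Real.rpow_le_rpow_of_exponent_le (by norm_num) (by norm_num)).trans_eq
      (Real.rpow_one 2)
  have e2 : (2 * x * (2 * y)) ^ (3 / 8 : ℝ) ≤ 2 * (x * y) ^ (12 / 25 : ℝ) := by
    rw [show 2 * x * (2 * y) = 4 * (x * y) by ring, Real.mul_rpow (by norm_num) (by positivity)]
    have h4 : (4 : ℝ) ^ (3 / 8 : ℝ) ≤ 2 := by
      calc (4 : ℝ) ^ (3 / 8 : ℝ) ≤ 4 ^ (1 / 2 : ℝ) :=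
            Real.rpow_le_rpow_of_exponent_le (by norm_num) (by norm_num)
        _ = 2 := by
            rw [← Real.sqrt_eq_rpow, show (4 : ℝ) = 2 ^ 2 by norm_num]; simp
    exact mul_le_mul h4 (Real.rpow_le_rpow_of_exponent_le hxy (by norm_num)) (by positivity)
      (by norm_num)
  have e3 : 1 ≤ a ^ (-(12 / 25) : ℝ) * N ^ (-(12 / 25) : ℝ) * w ^ (12 / 25 : ℝ) := by
    rw [← Real.mul_rpow ha.le hN.le, Real.rpow_neg (by positivity), inv_mul_eq_div,
      one_le_div (by positivity)]
    gcongr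
  calc C * ((2 * R) ^ (3 / 4 : ℝ) * (2 * x * (2 * y)) ^ (3 / 8 : ℝ))
      ≤ C * ((2 * R ^ (3 / 4 : ℝ)) * (2 * (x * y) ^ (12 / 25 : ℝ))) := by gcongr
    _ = C * ((2 * R ^ (3 / 4 : ℝ)) * (2 * (x * y) ^ (12 / 25 : ℝ))) * 1 := (mul_one _).symm
    _ ≤ C * ((2 * R ^ (3 / 4 : ℝ)) * (2 * (x * y) ^ (12 / 25 : ℝ))) *
        (a ^ (-(12 / 25) : ℝ) * N ^ (-(12 / 25) : ℝ) * w ^ (12 / 25 : ℝ)) := by gcongr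
    _ = _ := by
        rw [Real.mul_rpow (x := x * y) (by positivity) hw0.le]; ring

/-- The trilinear convolution estimate for dyadic pieces in a high-low interaction. -/
theorem exists_convForm_le {c : ℝ} (hc0 : 0 < c) (hc1 : c < 1) :
    ∃ C : ℝ, 0 < C ∧ ∀ (ε σ : ℝ), (ε = 1 ∨ ε = -1) → (σ = 1 ∨ σ = -1) →
      ∀ u v w : SpaceTime → ℝ≥0∞, Measurable u → Measurable v → Measurable w →
      ∀ n₀ n₁ n₂ l₀ l₁ l₂ : ℕ, MuchLess c (dyadic n₁) (dyadic n₀) →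
      (∀ p, u p ≠ 0 → (2 * Real.pi) • p ∈ region σ c n₀ l₀) →
      (∀ p, v p ≠ 0 → (2 * Real.pi) • p ∈ region ε 1 n₂ l₂) →
      (∀ p, w p ≠ 0 → (2 * Real.pi) • p ∈ region (-ε) 1 n₁ l₁) →
      convForm u v w ≤ ENNReal.ofReal (C * (dyadic n₁ ^ (3 / 4 : ℝ) *
          dyadic n₀ ^ (-(12 / 25) : ℝ) * (dyadic l₀ * dyadic l₁ * dyadic l₂) ^ (12 / 25 : ℝ))) *
        (l2Norm volume u * l2Norm volume v * l2Norm volume w) := by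
  obtain ⟨C₁, hC₁, htr⟩ := exists_convForm_transverse_le hc0.le hc1
  set C₂ := max C₁ (2 * Real.sqrt 16)
  have hC₂ : 0 < C₂ := lt_max_of_lt_left hC₁
  have ha : 0 < (1 - c) / 24 := div_pos (by linarith) (by norm_num)
  refine ⟨C₂ * 4 * ((1 - c) / 24) ^ (-(12 / 25) : ℝ), by positivity, ?_⟩
  intro ε σ hε hσ u v w hu hv hw n₀ n₁ n₂ l₀ l₁ l₂ hn hus hvs hws
  have hε' : -ε = 1 ∨ -ε = -1 := by rcases hε with rfl | rfl <;> simp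
  have hN₁ := dyadic_pos n₁
  have hN₀ := dyadic_pos n₀
  have hl : ∀ l, 0 < 2 * dyadic l := fun l => mul_pos two_pos (dyadic_pos l)
  have mb : ∀ {ε' a : ℝ} {n l : ℕ} {p : SpaceTime}, p ∈ region ε' a n l →
      |modulation ε' a p| ≤ 2 * dyadic l := fun h => (abs_le_bracket _).trans h.2.2
  have hlow : ∀ p, w p ≠ 0 → ‖spatial ((2 * Real.pi) • p)‖ ≤ 2 * dyadic n₁ := fun p hp =>
    (norm_le_bracket _).trans (hws p hp).1.2
  -- For a dominant `l₁`: the two high-frequency functions are paired, across cones of speeds `c`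
  -- and 1, with low-frequency output.
  have p1 : convForm u v w ≤ bilinearBound C₂ (2 * dyadic n₁) (2 * dyadic l₂) (2 * dyadic l₀) *
      (l2Norm volume u * l2Norm volume v * l2Norm volume w) := by
    refine (htr ε σ hε hσ u v w hu hv hw (2 * dyadic n₁) (2 * dyadic l₂) (2 * dyadic l₀)
      (by positivity) (hl _) (hl _) (fun p hp => mb (hus p hp)) (fun p hp => mb (hvs p hp))
      (Or.inr hlow)).trans ?_
    gcongr
    exact bilinearBound_mono (le_max_left _ _) (by positivity) (hl _).le (hl _).le
  -- For a dominant `l₂`: the speed-`c` function is paired with the low-frequency one.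
  have p2 : convForm u v w ≤ bilinearBound C₂ (2 * dyadic n₁) (2 * dyadic l₁) (2 * dyadic l₀) *
      (l2Norm volume u * l2Norm volume v * l2Norm volume w) := by
    rw [convForm_right_comm hu hv hw, mul_right_comm (l2Norm volume u)]
    refine (htr (-ε) σ hε' hσ u w v hu hw hv (2 * dyadic n₁) (2 * dyadic l₁) (2 * dyadic l₀)
      (by positivity) (hl _) (hl _) (fun p hp => mb (hus p hp)) (fun p hp => mb (hws p hp))
      (Or.inl hlow)).trans ?_
    gcongr
    exact bilinearBound_mono (le_max_left _ _) (by positivity) (hl _).le (hl _).le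
  -- For a dominant `l₀`: both remaining cones have speed 1, so transversality fails and the
  -- opposite signs and separated frequencies are used instead.
  have p0 : convForm u v w ≤ bilinearBound C₂ (2 * dyadic n₁) (2 * dyadic l₁) (2 * dyadic l₂) *
      (l2Norm volume u * l2Norm volume v * l2Norm volume w) := by
    rw [convForm_comm u v w, convForm_right_comm hv hu hw]
    have h := convForm_opposite_le (ε := -ε) hε' hv hw hu (ρ := 2 * dyadic n₁)
      (L₁ := 2 * dyadic l₁) (L₂ := 2 * dyadic l₂) (by positivity) (hl _) (hl _)
      (fun p hp => by rw [neg_neg]; exact mb (hvs p hp)) (fun p hp => mb (hws p hp)) hlow ?_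
    · refine h.trans ?_
      rw [show l2Norm volume v * l2Norm volume w * l2Norm volume u =
        l2Norm volume u * l2Norm volume v * l2Norm volume w by ring]
      gcongr
      exact bilinearBound_mono (le_max_right _ _) (by positivity) (hl _).le (hl _).le
    · intro r q hr hp hq
      have hsum : spatial ((2 * Real.pi) • q) + spatial ((2 * Real.pi) • (-r - q)) =
          -spatial ((2 * Real.pi) • r) := by
        rw [← spatial_add, ← spatial_neg, ← smul_add, ← smul_neg]; congr 2; abel
      have h₀ : dyadic n₀ ≤ bracket (spatial ((2 * Real.pi) • q) +
          spatial ((2 * Real.pi) • (-r - q))) := by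
        rw [hsum, bracket_neg]; exact (hus r hr).1.1
      have hsep := (separated_of_muchLess hc0 hc1 (one_le_dyadic _) hn h₀ (hws q hq).1.2).1
      have hδ : (1 - c) / (2 * (1 + c)) ≤ 1 / 2 := by
        rw [div_le_div_iff₀ (by linarith) (by norm_num)]; linarith
      nlinarith [norm_nonneg (spatial ((2 * Real.pi) • (-r - q)))]
  -- One interacting triple suffices to learn which dyadic modulation is large; if there is none,
  -- the form vanishes.
  by_cases hzero : ∃ r p q : SpaceTime, r + p + q = 0 ∧ u r ≠ 0 ∧ v p ≠ 0 ∧ w q ≠ 0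
  · obtain ⟨r, p, q, hsum, hr, hp, hq⟩ := hzero
    have hsum' : (2 * Real.pi) • r + (2 * Real.pi) • p + (2 * Real.pi) • q = 0 := by
      rw [← smul_add, ← smul_add, hsum, smul_zero]
    rcases le_modulation_of_mem_region hc0 hc1 hε hσ hn hsum' (hus r hr) (hvs p hp) (hws q hq)
      with h | h | h
    · refine p0.trans (mul_le_mul_left ((bilinearBound_le hC₂ ha hN₀ hN₁ (one_le_dyadic _)
        (one_le_dyadic _) h).trans_eq ?_) _)
      congr 4; ring
    · refine p1.trans (mul_le_mul_left ((bilinearBound_le hC₂ ha hN₀ hN₁ (one_le_dyadic _)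
        (one_le_dyadic _) h).trans_eq ?_) _)
      congr 4; ring
    · refine p2.trans (mul_le_mul_left ((bilinearBound_le hC₂ ha hN₀ hN₁ (one_le_dyadic _)
        (one_le_dyadic _) h).trans_eq ?_) _)
      congr 4; ring
  · have : convForm u v w = 0 := by
      unfold convForm
      have hz : ∀ r q, w r * (u (-r - q) * v q) = 0 := by
        intro r q
        by_contra h
        refine hzero ⟨-r - q, q, r, by abel, fun h' => h (by simp [h']), fun h' => h (by simp [h']),
          fun h' => h (by simp [h'])⟩
      have : ∀ r, w r * ∫⁻ q, u (-r - q) * v q = 0 := by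
        intro r
        rw [← lintegral_const_mul (w r) (f := fun q => u (-r - q) * v q) (by fun_prop)]
        simp [hz]
      simp [this]
    rw [this]; exact zero_le

/-! ### Transfer to the Fourier projections -/

theorem measurableSet_region (σ a : ℝ) (n l : ℕ) : MeasurableSet (region σ a n l) := by
  have hb : ∀ {E : Type} [NormedAddCommGroup E], Continuous (bracket : E → ℝ) := by
    intro E _
    unfold bracket
    fun_prop
  have h1 : Continuous fun p : SpaceTime => bracket (spatial p) := hb.comp continuous_spatial
  have h2 : Continuous fun p : SpaceTime => bracket (modulation σ a p) :=
    hb.comp (continuous_modulation σ a)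
  exact ((measurableSet_le measurable_const h1.measurable).inter
    (measurableSet_le h1.measurable measurable_const)).inter
    ((measurableSet_le measurable_const h2.measurable).inter
      (measurableSet_le h2.measurable measurable_const))

/-- The Fourier transform of `f`, cut off to a set of angular frequencies. -/
noncomputable def cutoff (K : Set SpaceTime) (f : 𝓢(SpaceTime, ℂ)) : SpaceTime → ℂ :=
  Set.indicator {η : SpaceTime | (2 * Real.pi) • η ∈ K} (𝓕 (f : SpaceTime → ℂ))

section cutoff

variable {K : Set SpaceTime} (f : 𝓢(SpaceTime, ℂ))

theorem mem_of_cutoff_ne_zero {p : SpaceTime} (h : ‖cutoff K f p‖ₑ ≠ 0) :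
    (2 * Real.pi) • p ∈ K := by
  by_contra hp
  exact h (by rw [cutoff, Set.indicator_of_notMem (by exact hp), enorm_zero])

theorem measurableSet_smul_mem (hK : MeasurableSet K) :
    MeasurableSet {η : SpaceTime | (2 * Real.pi) • η ∈ K} :=
  (measurable_const_smul (2 * Real.pi)) hK

theorem measurable_enorm_cutoff (hK : MeasurableSet K) : Measurable fun p => ‖cutoff K f p‖ₑ := by
  refine Measurable.enorm (Measurable.indicator ?_ (measurableSet_smul_mem hK))
  rw [← SchwartzMap.fourier_coe]
  exact (𝓕 f).continuous.measurable

theorem integrable_cutoff (hK : MeasurableSet K) : Integrable (cutoff K f) := by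
  refine Integrable.indicator ?_ (measurableSet_smul_mem hK)
  rw [← SchwartzMap.fourier_coe]
  exact (𝓕 f).integrable

theorem memLp_cutoff (hK : MeasurableSet K) : MemLp (cutoff K f) 2 := by
  refine MemLp.indicator (measurableSet_smul_mem hK) ?_
  rw [← SchwartzMap.fourier_coe]
  exact (𝓕 f).memLp 2

theorem l2Norm_cutoff (hK : MeasurableSet K) :
    l2Norm volume (fun p => ‖cutoff K f p‖ₑ) = eLpNorm (freqProj K f) 2 volume := by
  rw [← eLpNorm_two_eq_l2Norm]
  exact (eLpNorm_fourierInv_eq (integrable_cutoff f hK) (memLp_cutoff f hK)).symm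

end cutoff

theorem enorm_trilinear_le_convForm (c σ : ℝ) (f g₁ g₂ : 𝓢(SpaceTime, ℂ)) (n l : ℕ × ℕ × ℕ) :
    ‖trilinear c σ f g₁ g₂ n l‖ₑ ≤
      convForm (fun p => ‖cutoff (region (-1) 1 n.2.1 l.2.1) g₁ p‖ₑ)
        (fun p => ‖cutoff (region 1 1 n.2.2 l.2.2) g₂ p‖ₑ)
        (fun p => ‖cutoff (region σ c n.1 l.1) f p‖ₑ) :=
  have h := measurableSet_region
  enorm_integral_fourierInv_mul_le (integrable_cutoff g₁ (h _ _ _ _))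
    (memLp_cutoff g₁ (h _ _ _ _)) (integrable_cutoff g₂ (h _ _ _ _))
    (memLp_cutoff g₂ (h _ _ _ _)) (integrable_cutoff f (h _ _ _ _))

/-- The trilinear estimate for dyadic pieces, with `m` the exponent of the low frequency. -/
theorem exists_trilinear_le {c : ℝ} (hc0 : 0 < c) (hc1 : c < 1) :
    ∃ C : ℝ, 0 < C ∧ ∀ σ : ℝ, (σ = 1 ∨ σ = -1) → ∀ (f g₁ g₂ : 𝓢(SpaceTime, ℂ))
      (n l : ℕ × ℕ × ℕ), ∀ m, (m = n.2.1 ∨ m = n.2.2) → MuchLess c (dyadic m) (dyadic n.1) →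
      ‖trilinear c σ f g₁ g₂ n l‖ₑ ≤ ENNReal.ofReal (C * (dyadic m ^ (3 / 4 : ℝ) *
          dyadic n.1 ^ (-(12 / 25) : ℝ) *
          (dyadic l.1 * dyadic l.2.1 * dyadic l.2.2) ^ (12 / 25 : ℝ))) *
        (eLpNorm (freqProj (region σ c n.1 l.1) f) 2 volume *
          eLpNorm (freqProj (region (-1) 1 n.2.1 l.2.1) g₁) 2 volume *
          eLpNorm (freqProj (region 1 1 n.2.2 l.2.2) g₂) 2 volume) := by
  obtain ⟨C, hC, h⟩ := exists_convForm_le hc0 hc1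
  refine ⟨C, hC, ?_⟩
  intro σ hσ f g₁ g₂ n l m hm hn
  have hr := measurableSet_region
  have hu := measurable_enorm_cutoff f (hr σ c n.1 l.1)
  have hv := measurable_enorm_cutoff g₁ (hr (-1) 1 n.2.1 l.2.1)
  have hw := measurable_enorm_cutoff g₂ (hr 1 1 n.2.2 l.2.2)
  refine (enorm_trilinear_le_convForm c σ f g₁ g₂ n l).trans ?_
  rw [← l2Norm_cutoff f (hr _ _ _ _), ← l2Norm_cutoff g₁ (hr _ _ _ _),
    ← l2Norm_cutoff g₂ (hr _ _ _ _)]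
  rcases hm with rfl | rfl
  · rw [convForm_comm, convForm_right_comm hw hv hu, convForm_comm]
    refine (h 1 σ (Or.inl rfl) hσ _ _ _ hu hw hv n.1 n.2.1 n.2.2 l.1 l.2.1 l.2.2 hn
      (fun p => mem_of_cutoff_ne_zero f) (fun p => mem_of_cutoff_ne_zero g₂)
      (fun p => mem_of_cutoff_ne_zero g₁)).trans_eq ?_
    ring
  · rw [convForm_right_comm hv hw hu, convForm_comm]
    refine (h (-1) σ (Or.inr rfl) hσ _ _ _ hu hv hw n.1 n.2.2 n.2.1 l.1 l.2.2 l.2.1 hn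
      (fun p => mem_of_cutoff_ne_zero f) (fun p => mem_of_cutoff_ne_zero g₁)
      (fun p hp => by rw [neg_neg]; exact mem_of_cutoff_ne_zero g₂ hp)).trans_eq ?_
    rw [mul_right_comm (dyadic l.1)]

/-! ### Summation over the dyadic pieces -/

/-- The `ℓ²` norm of a sequence in `[0, ∞]`. -/
noncomputable def ellTwo (x : ℕ → ℝ≥0∞) : ℝ≥0∞ := (∑' n, x n ^ 2) ^ (1 / 2 : ℝ)

theorem le_ellTwo (x : ℕ → ℝ≥0∞) (n : ℕ) : x n ≤ ellTwo x := by
  rw [← sq_rpow_half (x n)]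
  exact ENNReal.rpow_le_rpow (ENNReal.le_tsum n) (by norm_num)

/-- The decay factor `N ^ (-1/200)`. -/
noncomputable def decay (n : ℕ) : ℝ≥0∞ := ENNReal.ofReal (dyadic n ^ (-(1 / 200) : ℝ))

theorem tsum_decay_ne_top : ∑' n, decay n ≠ ∞ := by
  have h : ∀ n, decay n = ENNReal.ofReal ((2 : ℝ) ^ (-(1 / 200) : ℝ)) ^ n := by
    intro n
    rw [decay, ← ENNReal.ofReal_pow (by positivity), dyadic, ← Real.rpow_natCast,
      ← Real.rpow_natCast, ← Real.rpow_mul (by norm_num), ← Real.rpow_mul (by norm_num), mul_comm]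
  simp only [h, ENNReal.tsum_geometric]
  rw [ENNReal.inv_ne_top, ne_eq, tsub_eq_zero_iff_le, not_le,
    ENNReal.ofReal_lt_one]
  exact Real.rpow_lt_one_of_one_lt_of_neg (by norm_num) (by norm_num)

/-- Almost diagonal sums. -/
theorem tsum_near_diagonal_le (P : ℕ → ℕ → Prop) [∀ i j, Decidable (P i j)] {k : ℕ}
    (hP : ∀ i j, P i j → i ≤ j + k ∧ j ≤ i + k) (x z : ℕ → ℝ≥0∞) :
    ∑' i, ∑' j, (if P i j then x i * z j else 0) ≤ (2 * k + 1 : ℕ) * (ellTwo x * ellTwo z) := by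
  -- Every row and every column meets the strip in at most `2k + 1` places, so each Cauchy–Schwarz
  -- factor loses the square root of that number.
  have hcount : ∀ (Q : ℕ → Prop) [DecidablePred Q] (i : ℕ),
      (∀ j, Q j → i ≤ j + k ∧ j ≤ i + k) →
      ∑' j, (if Q j then (1 : ℝ≥0∞) else 0) ≤ (2 * k + 1 : ℕ) := by
    intro Q _ i hQ
    rw [tsum_eq_sum (s := Finset.Icc (i - k) (i + k))]
    · refine (Finset.sum_le_card_nsmul _ _ 1 fun j _ => by split_ifs <;> simp).trans ?_
      rw [nsmul_eq_mul, mul_one, Nat.card_Icc]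
      exact_mod_cast (by omega)
    · intro j hj
      rw [if_neg]
      intro h
      have := hQ j h
      exact hj (Finset.mem_Icc.2 (by omega))
  have hx : ∀ i j, (if P i j then x i * z j else 0) =
      (if P i j then x i else 0) * (if P i j then z j else 0) := by
    intro i j; split_ifs <;> simp
  have hsum : ∑' i, ∑' j, (if P i j then x i * z j else 0) =
      ∫⁻ y : ℕ × ℕ, (if P y.1 y.2 then x y.1 else 0) * (if P y.1 y.2 then z y.2 else 0)
        ∂Measure.count := by
    rw [lintegral_count, ENNReal.tsum_prod']
    simp only [hx]
  rw [hsum]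
  refine (lintegral_mul_le_l2Norm _ (Measurable.of_discrete).aemeasurable
    (Measurable.of_discrete).aemeasurable).trans ?_
  have h1 : l2Norm Measure.count (fun y : ℕ × ℕ => if P y.1 y.2 then x y.1 else 0) ≤
      ((2 * k + 1 : ℕ) : ℝ≥0∞) ^ (1 / 2 : ℝ) * ellTwo x := by
    rw [l2Norm, lintegral_count, ENNReal.tsum_prod', ellTwo,
      ← ENNReal.mul_rpow_of_nonneg _ _ (by norm_num), ← ENNReal.tsum_mul_left]
    refine ENNReal.rpow_le_rpow (ENNReal.tsum_le_tsum fun i => ?_) (by norm_num)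
    have : ∀ j, (if P i j then x i else 0) ^ 2 = (if P i j then 1 else 0) * x i ^ 2 := by
      intro j; split_ifs <;> simp
    simp only [this, ENNReal.tsum_mul_right]
    gcongr
    exact hcount (P i) i fun j h => hP i j h
  have h2 : l2Norm Measure.count (fun y : ℕ × ℕ => if P y.1 y.2 then z y.2 else 0) ≤
      ((2 * k + 1 : ℕ) : ℝ≥0∞) ^ (1 / 2 : ℝ) * ellTwo z := by
    rw [l2Norm, lintegral_count, ENNReal.tsum_prod', ellTwo, ENNReal.tsum_comm,
      ← ENNReal.mul_rpow_of_nonneg _ _ (by norm_num), ← ENNReal.tsum_mul_left]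
    refine ENNReal.rpow_le_rpow (ENNReal.tsum_le_tsum fun j => ?_) (by norm_num)
    have : ∀ i, (if P i j then z j else 0) ^ 2 = (if P i j then 1 else 0) * z j ^ 2 := by
      intro i; split_ifs <;> simp
    simp only [this, ENNReal.tsum_mul_right]
    gcongr
    exact hcount (fun i => P i j) j fun i h => (hP i j h).symm
  calc _ ≤ (((2 * k + 1 : ℕ) : ℝ≥0∞) ^ (1 / 2 : ℝ) * ellTwo x) *
        (((2 * k + 1 : ℕ) : ℝ≥0∞) ^ (1 / 2 : ℝ) * ellTwo z) := mul_le_mul' h1 h2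
    _ = (((2 * k + 1 : ℕ) : ℝ≥0∞) ^ (1 / 2 : ℝ)) ^ 2 * (ellTwo x * ellTwo z) := by ring
    _ = _ := by rw [rpow_half_sq]

/-- The weighted norm of a dyadic piece. -/
noncomputable def pieceNorm (s b σ a : ℝ) (f : 𝓢(SpaceTime, ℂ)) (n l : ℕ) : ℝ≥0∞ :=
  ENNReal.ofReal (dyadic n ^ s * dyadic l ^ b) *
    eLpNorm (freqProj (region σ a n l) f) 2 volume

theorem bourgainNorm_eq (s b σ a : ℝ) (f : 𝓢(SpaceTime, ℂ)) :
    bourgainNorm s b σ a f = ellTwo fun n => ellTwo (pieceNorm s b σ a f n) := by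
  unfold bourgainNorm ellTwo
  simp only [rpow_half_sq]
  congr 3; ext n; congr 1; ext l
  have hn := dyadic_pos n
  have hl := dyadic_pos l
  rw [pieceNorm, mul_pow, ← ENNReal.ofReal_pow (by positivity), mul_pow,
    ← Real.rpow_natCast (dyadic n ^ s), ← Real.rpow_natCast (dyadic l ^ b),
    ← Real.rpow_mul hn.le, ← Real.rpow_mul hl.le]
  norm_num [mul_comm]

/-- `R` is the low frequency; the four parts are `I₁`, `I₂` with `g₁` low, then `I₁`, `I₂` with `g₂`
low. Up to powers of `κ`, all but the third require `R^(-1/4 - s + 1/200) ≤ N^(12/25)`, and the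
third requires `R^(3/4 + s + 1/200) ≤ N^(37/25 + 2s)`. As `1 ≤ R ≤ N`, all follow from `s ≥ -29/40`.
-/
theorem frequency_weight_le {s κ N M R : ℝ} (hs : -(13 / 18) < s) (hs0 : s < 0) (hκ : 1 ≤ κ)
    (hR : 1 ≤ R) (hRN : R ≤ N) (hNM : N ≤ κ * M) (hMN : M ≤ κ * N) :
    (R⁻¹ * (R ^ (3 / 4 : ℝ) * N ^ (-(12 / 25) : ℝ)) ≤
      κ ^ (2 : ℝ) * (R ^ (-(1 / 200) : ℝ) * (N ^ s * R ^ s * M ^ (-s)))) ∧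
    (N * R⁻¹ * M⁻¹ * (R ^ (3 / 4 : ℝ) * N ^ (-(12 / 25) : ℝ)) ≤
      κ ^ (2 : ℝ) * (R ^ (-(1 / 200) : ℝ) * (N ^ (-s) * R ^ s * M ^ s))) ∧
    (M⁻¹ * (R ^ (3 / 4 : ℝ) * N ^ (-(12 / 25) : ℝ)) ≤
      κ ^ (2 : ℝ) * (R ^ (-(1 / 200) : ℝ) * (N ^ s * M ^ s * R ^ (-s)))) ∧
    (N * M⁻¹ * R⁻¹ * (R ^ (3 / 4 : ℝ) * N ^ (-(12 / 25) : ℝ)) ≤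
      κ ^ (2 : ℝ) * (R ^ (-(1 / 200) : ℝ) * (N ^ (-s) * M ^ s * R ^ s))) := by
  have hR0 : 0 < R := by linarith
  have hN0 : 0 < N := by linarith
  have hκ0 : 0 < κ := by linarith
  have hM0 : 0 < M := by
    by_contra! h
    nlinarith
  -- In logarithmic variables the claims are linear in `ν, μ, ρ, k`, with coefficients depending on
  -- `s`; `h1` to `h5` are the products needed.
  obtain ⟨ν, rfl⟩ : ∃ ν, N = Real.exp ν := ⟨Real.log N, (Real.exp_log hN0).symm⟩
  obtain ⟨μ, rfl⟩ : ∃ μ, M = Real.exp μ := ⟨Real.log M, (Real.exp_log hM0).symm⟩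
  obtain ⟨ρ, rfl⟩ : ∃ ρ, R = Real.exp ρ := ⟨Real.log R, (Real.exp_log hR0).symm⟩
  obtain ⟨k, rfl⟩ : ∃ k, κ = Real.exp k := ⟨Real.log κ, (Real.exp_log hκ0).symm⟩
  rw [Real.one_le_exp_iff] at hκ hR
  rw [Real.exp_le_exp] at hRN
  rw [← Real.exp_add, Real.exp_le_exp] at hNM hMN
  simp only [← Real.exp_mul, ← Real.exp_neg, ← Real.exp_add, Real.exp_le_exp]
  have h1 : 0 ≤ (s + 13 / 18) * ρ := mul_nonneg (by linarith) hR
  have h2 : 0 ≤ -s * (k + μ - ν) := mul_nonneg (by linarith) (by linarith)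
  have h3 : 0 ≤ -s * (k + ν - μ) := mul_nonneg (by linarith) (by linarith)
  have h4 : 0 ≤ (1 + s) * k := mul_nonneg (by linarith) hκ
  have h5 : 0 ≤ (s + 13 / 18) * (ν - ρ) := mul_nonneg (by linarith) (by linarith)
  refine ⟨?_, ?_, ?_, ?_⟩ <;> nlinarith

/-- `49/100` is the smaller of the two modulation weights `b` and `1 - b` for `b = 51/100`; the gap
to `12/25` pays for the decay. -/
theorem modulation_weight_le {L b : ℝ} (hL : 1 ≤ L) (hb : 49 / 100 ≤ b) :
    L ^ (12 / 25 : ℝ) ≤ L ^ (-(1 / 200) : ℝ) * L ^ b := by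
  rw [← Real.rpow_add (by linarith)]
  exact Real.rpow_le_rpow_of_exponent_le hL (by linarith)

theorem ofReal_mul_trilinear_le {W C K R b₀ b₁ b₂ s₀ s₁ s₂ c σ : ℝ} {f g₁ g₂ : 𝓢(SpaceTime, ℂ)}
    {n l : ℕ × ℕ × ℕ} (hW0 : 0 ≤ W) (hC : 0 < C) (hK : 0 ≤ K) (hR : 0 < R)
    (hb₀ : 49 / 100 ≤ b₀) (hb₁ : 49 / 100 ≤ b₁) (hb₂ : 49 / 100 ≤ b₂)
    (hW : W * (R ^ (3 / 4 : ℝ) * dyadic n.1 ^ (-(12 / 25) : ℝ)) ≤ K * (R ^ (-(1 / 200) : ℝ) *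
      (dyadic n.1 ^ s₀ * dyadic n.2.1 ^ s₁ * dyadic n.2.2 ^ s₂)))
    (h : ‖trilinear c σ f g₁ g₂ n l‖ₑ ≤ ENNReal.ofReal (C * (R ^ (3 / 4 : ℝ) *
          dyadic n.1 ^ (-(12 / 25) : ℝ) *
          (dyadic l.1 * dyadic l.2.1 * dyadic l.2.2) ^ (12 / 25 : ℝ))) *
        (eLpNorm (freqProj (region σ c n.1 l.1) f) 2 volume *
          eLpNorm (freqProj (region (-1) 1 n.2.1 l.2.1) g₁) 2 volume *
          eLpNorm (freqProj (region 1 1 n.2.2 l.2.2) g₂) 2 volume)) :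
    ENNReal.ofReal (W * ‖trilinear c σ f g₁ g₂ n l‖) ≤
      ENNReal.ofReal (C * K) * ENNReal.ofReal (R ^ (-(1 / 200) : ℝ)) *
        (decay l.1 * decay l.2.1 * decay l.2.2) *
        (pieceNorm s₀ b₀ σ c f n.1 l.1 * pieceNorm s₁ b₁ (-1) 1 g₁ n.2.1 l.2.1 *
          pieceNorm s₂ b₂ 1 1 g₂ n.2.2 l.2.2) := by
  have hp := dyadic_pos
  have h1 := one_le_dyadic
  rw [ENNReal.ofReal_mul hW0, ofReal_norm]
  set A₀ := eLpNorm (freqProj (region σ c n.1 l.1) f) 2 volume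
  set A₁ := eLpNorm (freqProj (region (-1) 1 n.2.1 l.2.1) g₁) 2 volume
  set A₂ := eLpNorm (freqProj (region 1 1 n.2.2 l.2.2) g₂) 2 volume
  have hreal : W * (C * (R ^ (3 / 4 : ℝ) * dyadic n.1 ^ (-(12 / 25) : ℝ) *
      (dyadic l.1 * dyadic l.2.1 * dyadic l.2.2) ^ (12 / 25 : ℝ))) ≤
      (C * K) * R ^ (-(1 / 200) : ℝ) * (dyadic l.1 ^ (-(1 / 200) : ℝ) *
        dyadic l.2.1 ^ (-(1 / 200) : ℝ) * dyadic l.2.2 ^ (-(1 / 200) : ℝ)) *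
      ((dyadic n.1 ^ s₀ * dyadic l.1 ^ b₀) * (dyadic n.2.1 ^ s₁ * dyadic l.2.1 ^ b₁) *
        (dyadic n.2.2 ^ s₂ * dyadic l.2.2 ^ b₂)) := by
    rw [Real.mul_rpow (mul_pos (hp _) (hp _)).le (hp _).le, Real.mul_rpow (hp _).le (hp _).le]
    have e0 := modulation_weight_le (h1 l.1) hb₀
    have e1 := modulation_weight_le (h1 l.2.1) hb₁
    have e2 := modulation_weight_le (h1 l.2.2) hb₂
    have hq : ∀ (m : ℕ) (x : ℝ), 0 ≤ dyadic m ^ x := fun m x => Real.rpow_nonneg (hp m).le x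
    have hq2 : ∀ (m : ℕ) (x y : ℝ), 0 ≤ dyadic m ^ x * dyadic m ^ y := fun m x y =>
      mul_nonneg (hq _ _) (hq _ _)
    have e := mul_le_mul (mul_le_mul e0 e1 (hq _ _) (hq2 _ _ _)) e2 (hq _ _)
      (mul_nonneg (hq2 _ _ _) (hq2 _ _ _))
    have e' := mul_le_mul_of_nonneg_left (mul_le_mul hW e
      (mul_nonneg (mul_nonneg (hq _ _) (hq _ _)) (hq _ _))
      (mul_nonneg hK (mul_nonneg (Real.rpow_nonneg hR.le _)
        (mul_nonneg (mul_nonneg (hq _ _) (hq _ _)) (hq _ _))))) hC.le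
    refine (le_of_eq ?_).trans (e'.trans (le_of_eq ?_)) <;> ring
  have hn : ∀ (m : ℕ) (x : ℝ), 0 < dyadic m ^ x := fun m x => Real.rpow_pos_of_pos (hp m) x
  have hRp : 0 < R ^ (-(1 / 200) : ℝ) := Real.rpow_pos_of_pos hR _
  have hCK : 0 ≤ C * K := by positivity
  calc ENNReal.ofReal W * ‖trilinear c σ f g₁ g₂ n l‖ₑ
      ≤ ENNReal.ofReal W * (ENNReal.ofReal (C * (R ^ (3 / 4 : ℝ) *
          dyadic n.1 ^ (-(12 / 25) : ℝ) *
          (dyadic l.1 * dyadic l.2.1 * dyadic l.2.2) ^ (12 / 25 : ℝ))) * (A₀ * A₁ * A₂)) := by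
        gcongr
    _ = ENNReal.ofReal (W * (C * (R ^ (3 / 4 : ℝ) * dyadic n.1 ^ (-(12 / 25) : ℝ) *
          (dyadic l.1 * dyadic l.2.1 * dyadic l.2.2) ^ (12 / 25 : ℝ)))) * (A₀ * A₁ * A₂) := by
        rw [ENNReal.ofReal_mul hW0, ← mul_assoc]
    _ ≤ _ * (A₀ * A₁ * A₂) := mul_le_mul_left (ENNReal.ofReal_le_ofReal hreal) _
    _ = _ := by
        simp only [pieceNorm, decay]
        have m0 := (hn l.1 (-(1 / 200))).le
        have m1 := (hn l.2.1 (-(1 / 200))).le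
        have m2 := (hn l.2.2 (-(1 / 200))).le
        have w0 := (mul_pos (hn n.1 s₀) (hn l.1 b₀)).le
        have w1 := (mul_pos (hn n.2.1 s₁) (hn l.2.1 b₁)).le
        have w2 := (mul_pos (hn n.2.2 s₂) (hn l.2.2 b₂)).le
        rw [ENNReal.ofReal_mul (mul_nonneg (mul_nonneg hCK hRp.le)
            (mul_nonneg (mul_nonneg m0 m1) m2)),
          ENNReal.ofReal_mul (mul_nonneg hCK hRp.le), ENNReal.ofReal_mul hCK,
          ENNReal.ofReal_mul (mul_nonneg m0 m1), ENNReal.ofReal_mul m0,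
          ENNReal.ofReal_mul (mul_nonneg w0 w1), ENNReal.ofReal_mul w0]
        ring

/-- No orthogonality in the modulations is needed: each term is at most its `ℓ²` norm and the decay
factors are summable. -/
theorem tsum_modulation_le {A : ℝ≥0∞} {α β γ : ℕ → ℝ≥0∞} {F : ℕ × ℕ × ℕ → ℝ≥0∞}
    (hF : ∀ l, F l ≤ A * (decay l.1 * decay l.2.1 * decay l.2.2) *
      (α l.1 * β l.2.1 * γ l.2.2)) :
    ∑' l, F l ≤ A * (∑' n, decay n) ^ 3 * (ellTwo α * ellTwo β * ellTwo γ) := by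
  have h : ∀ l, F l ≤ A * (ellTwo α * ellTwo β * ellTwo γ) *
      (decay l.1 * (decay l.2.1 * decay l.2.2)) := by
    intro l
    refine (hF l).trans ?_
    calc _ ≤ A * (decay l.1 * decay l.2.1 * decay l.2.2) * (ellTwo α * ellTwo β * ellTwo γ) := by
          gcongr <;> exact le_ellTwo _ _
      _ = _ := by ring
  refine (ENNReal.tsum_le_tsum h).trans_eq ?_
  rw [ENNReal.tsum_mul_left, ENNReal.tsum_prod']
  simp only [ENNReal.tsum_mul_left, ENNReal.tsum_prod', ENNReal.tsum_mul_right]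
  ring

-- The low frequency `m` is summed by decay alone; only the pair of comparable high frequencies
-- needs `ℓ²` summation.
open Classical in
theorem tsum_frequency_le {k : ℕ} {A : ℝ≥0∞} {x y z : ℕ → ℝ≥0∞} {F : ℕ × ℕ × ℕ → ℝ≥0∞}
    (hF : ∀ i m j, F (i, m, j) ≤
      if i ≤ j + k ∧ j ≤ i + k then A * decay m * (x i * y m * z j) else 0) :
    ∑' n, F n ≤ A * (∑' n, decay n) * (2 * k + 1 : ℕ) * (ellTwo x * ellTwo y * ellTwo z) := by
  have h : ∀ i m j, F (i, m, j) ≤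
      A * ellTwo y * decay m * (if i ≤ j + k ∧ j ≤ i + k then x i * z j else 0) := by
    intro i m j
    refine (hF i m j).trans ?_
    split_ifs
    · calc A * decay m * (x i * y m * z j) ≤ A * decay m * (x i * ellTwo y * z j) := by
            gcongr; exact le_ellTwo _ _
        _ = _ := by ring
    · exact zero_le
  calc ∑' n, F n = ∑' m, ∑' i, ∑' j, F (i, m, j) := by
        simp only [ENNReal.tsum_prod']
        rw [ENNReal.tsum_comm]
    _ ≤ ∑' m, ∑' i, ∑' j, A * ellTwo y * decay m *
          (if i ≤ j + k ∧ j ≤ i + k then x i * z j else 0) :=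
        ENNReal.tsum_le_tsum fun m => ENNReal.tsum_le_tsum fun i => ENNReal.tsum_le_tsum fun j =>
          h i m j
    _ = A * ellTwo y * (∑' m, decay m) *
          ∑' i, ∑' j, (if i ≤ j + k ∧ j ≤ i + k then x i * z j else 0) := by
        simp only [ENNReal.tsum_mul_left, ENNReal.tsum_mul_right]
    _ ≤ A * ellTwo y * (∑' m, decay m) * ((2 * k + 1 : ℕ) * (ellTwo x * ellTwo z)) := by
        gcongr
        exact tsum_near_diagonal_le (fun i j => i ≤ j + k ∧ j ≤ i + k) (fun _ _ h => h) x z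
    _ = _ := by ring

theorem le_add_of_comparable {κ : ℝ} {k i j : ℕ} (hk : κ ≤ 2 ^ k)
    (h : Comparable κ (dyadic i) (dyadic j)) : i ≤ j + k ∧ j ≤ i + k := by
  have aux : ∀ i j : ℕ, dyadic i ≤ κ * dyadic j → i ≤ j + k := by
    intro i j hij
    have h2 : (2 : ℝ) ^ i ≤ 2 ^ (j + k) := by
      rw [pow_add, mul_comm]
      exact hij.trans (mul_le_mul_of_nonneg_right hk (dyadic_pos j).le)
    exact (pow_le_pow_iff_right₀ (by norm_num)).1 h2
  exact ⟨aux i j h.1, aux j i h.2⟩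

theorem tsum_regime₁_le {c κ : ℝ} {k : ℕ} (hk : κ ≤ 2 ^ k) {A : ℝ≥0∞} {x y z : ℕ → ℝ≥0∞}
    {F : ℕ × ℕ × ℕ → ℝ≥0∞}
    (hF : ∀ n ∈ regime₁ c κ, F n ≤ A * decay n.2.1 * (x n.1 * y n.2.1 * z n.2.2)) :
    ∑' n : regime₁ c κ, F n ≤
      A * (∑' n, decay n) * (2 * k + 1 : ℕ) * (ellTwo x * ellTwo y * ellTwo z) := by
  rw [tsum_subtype]
  refine tsum_frequency_le fun i m j => ?_
  by_cases hn : (i, m, j) ∈ regime₁ c κ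
  · rw [Set.indicator_of_mem hn, if_pos (le_add_of_comparable hk hn.2)]
    exact hF _ hn
  · rw [Set.indicator_of_notMem hn]; exact zero_le

theorem tsum_regime₂_le {c κ : ℝ} {k : ℕ} (hk : κ ≤ 2 ^ k) {A : ℝ≥0∞} {x y z : ℕ → ℝ≥0∞}
    {F : ℕ × ℕ × ℕ → ℝ≥0∞}
    (hF : ∀ n ∈ regime₂ c κ, F n ≤ A * decay n.2.2 * (x n.1 * y n.2.1 * z n.2.2)) :
    ∑' n : regime₂ c κ, F n ≤
      A * (∑' n, decay n) * (2 * k + 1 : ℕ) * (ellTwo x * ellTwo y * ellTwo z) := by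
  -- The last two indices are exchanged so that the low frequency again stands in the middle.
  rw [tsum_subtype, ← ((Equiv.refl ℕ).prodCongr (Equiv.prodComm ℕ ℕ)).tsum_eq,
    mul_right_comm (ellTwo x)]
  refine tsum_frequency_le fun i m j => ?_
  change (regime₂ c κ).indicator F (i, j, m) ≤ _
  by_cases hn : (i, j, m) ∈ regime₂ c κ
  · rw [Set.indicator_of_mem hn, if_pos (le_add_of_comparable hk hn.2), mul_right_comm (x i)]
    exact hF _ hn
  · rw [Set.indicator_of_notMem hn]; exact zero_le

theorem le_of_muchLess {c N M : ℝ} (hc0 : 0 < c) (hM : 0 ≤ M) (h : MuchLess c N M) : N ≤ M := by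
  refine le_trans h (mul_le_of_le_one_left hM ?_)
  rw [div_le_one (by linarith)]
  linarith

/-- The trilinear estimates, for all `-13/18 < s < 0` with `b = 51/100`. -/
theorem exists_regimeSum_le {s c κ : ℝ} (hs : -(13 / 18) < s) (hs0 : s < 0) (hc0 : 0 < c)
    (hc1 : c < 1) (hκ : 1 ≤ κ) :
    ∃ C : ℝ≥0, ∀ σ : ℝ, (σ = 1 ∨ σ = -1) → ∀ f g₁ g₂ : 𝓢(SpaceTime, ℂ),
      regimeSum c κ (I₁ c σ f g₁ g₂) ≤
        C * bourgainNorm s (51 / 100) σ c f * bourgainNorm s (51 / 100) (-1) 1 g₁ *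
          bourgainNorm (-s) (1 - 51 / 100) 1 1 g₂ ∧
      regimeSum c κ (I₂ c σ f g₁ g₂) ≤
        C * bourgainNorm (-s) (1 - 51 / 100) σ c f * bourgainNorm s (51 / 100) (-1) 1 g₁ *
          bourgainNorm s (51 / 100) 1 1 g₂ := by
  obtain ⟨C, hC, htri⟩ := exists_trilinear_le hc0 hc1
  obtain ⟨k, hk⟩ := pow_unbounded_of_one_lt κ (show (1 : ℝ) < 2 by norm_num)
  set D := ∑' n, decay n
  have hD : D ≠ ∞ := tsum_decay_ne_top
  set A : ℝ≥0∞ := ENNReal.ofReal (C * κ ^ (2 : ℝ)) * D ^ 3 with hA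
  -- `D ^ 3` inside `A` comes from the three modulation sums, the further `D` from the low
  -- frequency, `2k + 1` from the near-diagonal sum and 2 from the two regimes.
  set B : ℝ≥0∞ := 2 * (A * D * (2 * k + 1 : ℕ)) with hB
  have hBtop : B ≠ ∞ :=
    ENNReal.mul_ne_top (by simp) (ENNReal.mul_ne_top (ENNReal.mul_ne_top
      (ENNReal.mul_ne_top ENNReal.ofReal_ne_top (ENNReal.pow_ne_top hD)) hD)
      (ENNReal.natCast_ne_top _))
  refine ⟨B.toNNReal, fun σ hσ f g₁ g₂ => ?_⟩
  rw [ENNReal.coe_toNNReal hBtop]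
  have hp := dyadic_pos
  have hκ0 : 0 ≤ κ ^ (2 : ℝ) := by positivity
  have hw₁ : ∀ n ∈ regime₁ c κ, _ := fun n hn => frequency_weight_le hs hs0 hκ
    (one_le_dyadic n.2.1) (le_of_muchLess hc0 (hp _).le hn.1) hn.2.1 hn.2.2
  have hw₂ : ∀ n ∈ regime₂ c κ, _ := fun n hn => frequency_weight_le hs hs0 hκ
    (one_le_dyadic n.2.2) (le_of_muchLess hc0 (hp _).le hn.1) hn.2.1 hn.2.2
  have ht₁ : ∀ n ∈ regime₁ c κ, ∀ l, _ := fun n hn l =>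
    htri σ hσ f g₁ g₂ n l n.2.1 (Or.inl rfl) hn.1
  have ht₂ : ∀ n ∈ regime₂ c κ, ∀ l, _ := fun n hn l =>
    htri σ hσ f g₁ g₂ n l n.2.2 (Or.inr rfl) hn.1
  have hi : ∀ m, 0 ≤ (dyadic m)⁻¹ := fun m => inv_nonneg.2 (hp m).le
  have fin : ∀ X Y Z : ℝ≥0∞, A * D * (2 * k + 1 : ℕ) * (X * Y * Z) +
      A * D * (2 * k + 1 : ℕ) * (X * Y * Z) = B * X * Y * Z := fun X Y Z => by rw [hB]; ring
  have reorder : ∀ d : ℝ≥0∞, ENNReal.ofReal (C * κ ^ (2 : ℝ)) * d * D ^ 3 = A * d := fun d => by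
    rw [hA]; ring
  simp only [bourgainNorm_eq]
  constructor
  · rw [← fin]
    refine add_le_add (tsum_regime₁_le hk.le fun n hn => ?_)
      (tsum_regime₂_le hk.le fun n hn => ?_)
    · rw [← reorder]
      exact tsum_modulation_le fun l => ofReal_mul_trilinear_le (hi _) hC hκ0 (hp _)
        (by norm_num) (by norm_num) (by norm_num) (hw₁ n hn).1 (ht₁ n hn l)
    · rw [← reorder]
      exact tsum_modulation_le fun l => ofReal_mul_trilinear_le (hi _) hC hκ0 (hp _)
        (by norm_num) (by norm_num) (by norm_num) (hw₂ n hn).2.2.1 (ht₂ n hn l)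
  · rw [← fin]
    refine add_le_add (tsum_regime₁_le hk.le fun n hn => ?_)
      (tsum_regime₂_le hk.le fun n hn => ?_)
    · rw [← reorder]
      exact tsum_modulation_le fun l => ofReal_mul_trilinear_le
        (mul_nonneg (mul_nonneg (hp _).le (hi _)) (hi _)) hC hκ0 (hp _)
        (by norm_num) (by norm_num) (by norm_num) (hw₁ n hn).2.1 (ht₁ n hn l)
    · rw [← reorder]
      exact tsum_modulation_le fun l => ofReal_mul_trilinear_le
        (mul_nonneg (mul_nonneg (hp _).le (hi _)) (hi _)) hC hκ0 (hp _)
        (by norm_num) (by norm_num) (by norm_num) (hw₂ n hn).2.2.2 (ht₂ n hn l)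

end KGZ

theorem mainTheorem9 :
    -- the trilinear estimates
    (∀ s : ℝ, -(13 / 18) < s → s < 0 → ∃ b : ℝ, 1 / 2 < b ∧ b < 1 ∧
      ∀ c : ℝ, 0 < c → c < 1 → ∀ κ : ℝ, 1 ≤ κ → ∃ C : ℝ≥0,
        ∀ σ : ℝ, (σ = 1 ∨ σ = -1) → ∀ f g₁ g₂ : 𝓢(KGZ.SpaceTime, ℂ),
          KGZ.regimeSum c κ (KGZ.I₁ c σ f g₁ g₂) ≤
            C * KGZ.bourgainNorm s b σ c f * KGZ.bourgainNorm s b (-1) 1 g₁ *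
              KGZ.bourgainNorm (-s) (1 - b) 1 1 g₂ ∧
          KGZ.regimeSum c κ (KGZ.I₂ c σ f g₁ g₂) ≤
            C * KGZ.bourgainNorm (-s) (1 - b) σ c f * KGZ.bourgainNorm s b (-1) 1 g₁ *
              KGZ.bourgainNorm s b 1 1 g₂) ∧
    -- the modulation lower bound, for separated frequencies and in the two dyadic regimes
    (∀ c : ℝ, 0 < c → c < 1 → ∀ σ : ℝ, (σ = 1 ∨ σ = -1) → ∀ p₁ p₂ : KGZ.SpaceTime,
      ((‖KGZ.spatial p₂‖ ≤ (1 - c) / (2 * (1 + c)) * ‖KGZ.spatial p₁‖ ∨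
          ‖KGZ.spatial p₁‖ ≤ (1 - c) / (2 * (1 + c)) * ‖KGZ.spatial p₂‖) →
        KGZ.ModulationBound c σ p₁ p₂) ∧
      (∀ κ : ℝ, 1 ≤ κ → ∀ n ∈ KGZ.regime₁ c κ ∪ KGZ.regime₂ c κ,
        KGZ.InAnnulus n.1 (p₁ + p₂) → KGZ.InAnnulus n.2.1 p₁ → KGZ.InAnnulus n.2.2 p₂ →
          KGZ.ModulationBound c σ p₁ p₂)) := by
  refine ⟨fun s hs hs0 => ⟨51 / 100, by norm_num, by norm_num, fun c hc0 hc1 κ hκ =>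
    KGZ.exists_regimeSum_le hs hs0 hc0 hc1 hκ⟩, fun c hc0 hc1 σ hσ p₁ p₂ => ⟨fun h =>
    KGZ.modulationBound_of_separated hc0 hc1 hσ p₁ p₂ h, fun κ _ n hn h₀ h₁ h₂ =>
    KGZ.modulationBound_of_mem_regime hc0 hc1 hσ p₁ p₂ hn h₀ h₁ h₂⟩⟩
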